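/- For integers $a,b$ let $\operatorname{trig}^{a,b}=\sec^a\csc^b$, and for a positive integer $s$ let $$\psi_s^{a,b}(\tau)=\sum_{n=1}^{\infty}\frac{\operatorname{trig}^{a,b}(\pi n\tau)}{n^s}.$$ Write $D=\mathrm d/\mathrm d\tau$. At a real irrational point $\rho$, the derivative $D^j\psi_s^{a,b}$ is the termwise one, $$(D^j\psi_s^{a,b})(\rho)=\sum_{n=1}^{\infty}\frac{\mathrm d^j}{\mathrm d\tau^j}\left[\frac{\operatorname{trig}^{a,b}(\pi n\tau)}{n^s}\right]_{\tau=\rho}.$$ Let $(a,b)$ be one of $(1,0)$, $(0,1)$, $(-1,1)$, $(1,-1)$ (the secant, cosecant, cotangent and tangent series). Let $\rho$ be a real quadratic irrationality, that is, an irrational real root of a quadratic polynomial with integer coefficients, and let $j,s$ be nonnegative integers with $s\ge 2j+2$ and $s\equiv b\pmod 2$. Then the series defining $(D^j\psi_s^{a,b})(\rho)$ converges absolutely, and $$(D^j\psi_s^{a,b})(\rho)\in\pi^s\,\mathbb Q(\rho).$$ If, in addition, $\rho^2\in\mathbb Q$, then $$(D^j\psi_s^{a,b})(\rho)\in(\pi\rho)^s\rho^{j}\,\mathbb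 Q ;$$ in particular, $(D^j\psi_s^{a,b})(\rho)\in(\pi\rho)^s\,\mathbb Q$ if $j$ is even. -/

import Mathlib

namespace TrigDirichlet

noncomputable section

/-- The trigonometric function `trig^{a,b} = sec^a csc^b` for integers `a`, `b`, on the reals
(away from the zeros of `cos` and `sin`). -/
def trig (a b : ℤ) (x : ℝ) : ℝ :=
  ((Real.cos x)⁻¹) ^ a * ((Real.sin x)⁻¹) ^ b

/-- The `n`-th term `trig^{a,b}(π n τ) / n^s` of the trigonometric Dirichlet series, as a function
of `τ`. -/
def term (a b : ℤ) (s n : ℕ) (τ : ℝ) : ℝ :=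
  trig a b (Real.pi * n * τ) / (n : ℝ) ^ s

/-- The trigonometric Dirichlet series `ψ_s^{a,b}(τ) = ∑_{n ≥ 1} trig^{a,b}(π n τ) / n^s`. -/
def psi (a b : ℤ) (s : ℕ) (τ : ℝ) : ℝ :=
  ∑' n : ℕ, term a b s (n + 1) τ

/-- The `j`-th derivative `d^j/dτ^j` of the `n`-th term, at `τ`. At an irrational `τ` and for
`n ≥ 1` the term is smooth near `τ`, so that this is a genuine derivative. -/
def derivTerm (a b : ℤ) (j s n : ℕ) (τ : ℝ) : ℝ :=
  iteratedDeriv j (term a b s n) τ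

/-- The series `D^j ψ_s^{a,b}`, with `D = d/dτ`. The functions `ψ_s^{a,b}` have poles of their
terms at a dense set of rationals, so that at a real irrational point the derivative of the series
is, by definition, the series of the derivatives of its terms. -/
def derivPsi (a b : ℤ) (j s : ℕ) (τ : ℝ) : ℝ :=
  ∑' n : ℕ, derivTerm a b j s (n + 1) τ

/-- For `j = 0` the differentiated series is the series itself. -/
theorem derivPsi_zero (a b : ℤ) (s : ℕ) (τ : ℝ) : derivPsi a b 0 s τ = psi a b s τ := by
  simp [derivPsi, psi, derivTerm]

/-- A real quadratic irrationality: an irrational real root of a quadratic polynomial with integer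
coefficients. -/
def IsRealQuadraticIrrationality (ρ : ℝ) : Prop :=
  Irrational ρ ∧ ∃ A B C : ℤ, A ≠ 0 ∧ (A : ℝ) * ρ ^ 2 + (B : ℝ) * ρ + (C : ℝ) = 0

end

end TrigDirichlet

/-! Each of the four functions `trig^{a,b}(π n τ)` is, up to a rational multiple of `π`, an
Eisenstein series `∑ₘ h(m) (x + m)⁻¹` with weight `h` of period 4, at `x = nτ` (csc, cot) or `x =
2nτ` (sec, tan). Differentiating `j` times raises the exponent to `j + 1`. The parity condition
makes the summand even in `n`, so `D^j ψ_s` is a rational multiple of `π⁻¹` times a double sum `∑ₙ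
∑ₘ f(n, m) n^(-p) (nτ + m)^(-q)` with `p = s - j`, `q = j + 1` (`exists_derivPsi_eq`). The bound `s
≥ 2j + 2` is exactly `q + 1 ≤ p`.

These double sums behave like Eichler integrals of level 4. Under `τ ↦ τ + 1` and `τ ↦ -τ` only the
weight changes. Under `τ ↦ 1/τ` the order of summation is exchanged and partial fractions are
applied (`exists_doubleSum_inv`): up to a power of `τ` the sum reproduces itself, with error terms
of the same total weight `w = p + q` but smaller `q`, and a rational polynomial in `1/τ` times
`π^w`. By induction on `q` the errors at a quadratic `τ ∈ K` lie in `π^w K`, so the sum transforms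
under all of `SL(2, ℤ)` modulo `π^w K` (`isPiMultiple_homSum_slMap`).

Pell's equation gives a matrix congruent to 1 modulo 4 that fixes `τ` with an irrational eigenvalue
`η` (`exists_slMap_eq_mul`). Then `(η^(p-q) - 1)` times the double sum lies in `π^w K`, and the
factor is nonzero (`isPiMultiple_doubleSum`).

The coefficient in `K` is found simultaneously for all real embeddings. If `ρ² ∈ ℚ`, the conjugate
of `ρ` is `-ρ`, and comparing with the parity of `D^j ψ_s` kills one of the two coordinates of the
value in the basis `1, ρ`.

Convergence rests on `ρ` being badly approximable; the basic estimate is `∑ n⁻² |sin (π n ρ)|⁻¹ <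
∞`. -/

namespace TrigDirichlet

/-! ### Eisenstein series as polynomials in the cotangent. -/

open Polynomial in
/-- The polynomials `P_q` with `∑ₘ (x + m)^(-q) = π ^ q * P_q (cot (π x))`. -/
noncomputable def cotPoly : ℕ → ℚ[X]
  | 0 => 0
  | 1 => X
  | (q + 2) => C (1 / ((q : ℚ) + 1)) * ((1 + X ^ 2) * derivative (cotPoly (q + 1)))

/-- The Eisenstein series `∑ₘ (x + m)^(-q)`, `m ∈ ℤ`, in closed form (for `q = 1`: `π cot (π x)`). -/
noncomputable def eisen (q : ℕ) (x : ℝ) : ℝ :=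
  Real.pi ^ q * Polynomial.aeval (Real.cos (Real.pi * x) / Real.sin (Real.pi * x)) (cotPoly q)

theorem eisen_one (x : ℝ) :
    eisen 1 x = Real.pi * (Real.cos (Real.pi * x) / Real.sin (Real.pi * x)) := by
  simp [eisen, cotPoly]

theorem sin_pi_mul_ne_zero {x : ℝ} (hx : ∀ m : ℤ, x + m ≠ 0) : Real.sin (Real.pi * x) ≠ 0 := by
  intro h
  obtain ⟨k, hk⟩ := Real.sin_eq_zero_iff.1 h
  have : (k : ℝ) = x := by
    have := Real.pi_ne_zero
    apply mul_right_cancel₀ this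
    linarith
  exact hx (-k) (by push_cast; linarith)

theorem add_intCast_ne_zero_of_sin {x : ℝ} (h : Real.sin (Real.pi * x) ≠ 0) (m : ℤ) :
    x + m ≠ 0 := by
  intro hm
  apply h
  rw [Real.sin_eq_zero_iff]
  exact ⟨-m, by push_cast; rw [show x = -m by linarith]; ring⟩

theorem hasDerivAt_eisen (q : ℕ) {x : ℝ} (hx : ∀ m : ℤ, x + m ≠ 0) :
    HasDerivAt (eisen (q + 1)) (-(q + 1) * eisen (q + 2) x) x := by
  have hs := sin_pi_mul_ne_zero hx
  have h1 : HasDerivAt (fun y : ℝ => Real.pi * y) Real.pi x := by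
    simpa using (hasDerivAt_id x).const_mul Real.pi
  have hc : HasDerivAt (fun y : ℝ => Real.cos (Real.pi * y) / Real.sin (Real.pi * y))
      (-Real.pi * (1 + (Real.cos (Real.pi * x) / Real.sin (Real.pi * x)) ^ 2)) x := by
    convert! h1.cos.div h1.sin hs using 1
    field_simp
    ring
  have h2 := ((cotPoly (q + 1)).hasDerivAt_aeval
    (Real.cos (Real.pi * x) / Real.sin (Real.pi * x))).comp x hc
  convert! h2.const_mul (Real.pi ^ (q + 1)) using 1
  simp only [eisen, cotPoly, map_mul, map_add, map_pow, Polynomial.aeval_X, Polynomial.aeval_C,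
    map_one]
  have : ((q : ℝ) + 1) ≠ 0 := by positivity
  simp only [Rat.cast_div, Rat.cast_one, Rat.cast_add, Rat.cast_natCast, eq_ratCast]
  field_simp
  ring

theorem eisen_add_one (q : ℕ) (x : ℝ) : eisen q (x + 1) = eisen q x := by
  simp only [eisen, mul_add, mul_one, Real.cos_add_pi, Real.sin_add_pi, neg_div_neg_eq]

theorem eisen_add_int (q : ℕ) (x : ℝ) (k : ℤ) : eisen q (x + k) = eisen q x := by
  have h : Function.Periodic (eisen q) 1 := eisen_add_one q
  simpa using h.int_mul k x

theorem natDegree_cotPoly_le (q : ℕ) : (cotPoly q).natDegree ≤ q := by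
  induction q with
  | zero => simp [cotPoly]
  | succ q ih =>
    match q, ih with
    | 0, _ => simp [cotPoly]
    | q + 1, ih =>
      rw [cotPoly]
      refine Polynomial.natDegree_C_mul_le _ _ |>.trans (Polynomial.natDegree_mul_le.trans ?_)
      have h1 : ((1 : Polynomial ℚ) + Polynomial.X ^ 2).natDegree ≤ 2 := by compute_degree
      have h2 := Polynomial.natDegree_derivative_le (cotPoly (q + 1))
      omega

theorem exists_abs_eisen_le (q : ℕ) : ∃ C : ℝ, ∀ x : ℝ,
    Real.sin (Real.pi * x) ≠ 0 → |eisen q x| ≤ C * (|Real.sin (Real.pi * x)| ^ q)⁻¹ := by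
  refine ⟨Real.pi ^ q * ∑ i ∈ Finset.range (q + 1), |((cotPoly q).coeff i : ℝ)|, fun x hx => ?_⟩
  have hpos : 0 < |Real.sin (Real.pi * x)| := abs_pos.2 hx
  have hle := Real.abs_sin_le_one (Real.pi * x)
  have hcos := Real.abs_cos_le_one (Real.pi * x)
  rw [eisen, abs_mul, abs_of_pos (pow_pos Real.pi_pos q), mul_assoc]
  gcongr
  rw [Polynomial.aeval_eq_sum_range' (Nat.lt_succ_of_le (natDegree_cotPoly_le q)), Finset.sum_mul]
  refine (Finset.abs_sum_le_sum_abs _ _).trans (Finset.sum_le_sum fun i hi => ?_)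
  rw [Algebra.smul_def, abs_mul, abs_pow, abs_div]
  simp only [eq_ratCast]
  gcongr
  rw [div_pow, div_eq_mul_inv]
  have hi' : i ≤ q := Nat.lt_succ_iff.1 (Finset.mem_range.1 hi)
  calc _ ≤ 1 * (|Real.sin (Real.pi * x)| ^ i)⁻¹ := by
        gcongr
        exact pow_le_one₀ (abs_nonneg _) hcos
    _ ≤ _ := by
        rw [one_mul]
        apply inv_anti₀ (pow_pos hpos q)
        exact pow_le_pow_of_le_one hpos.le hle hi'

theorem summable_inv_add_int_pow (x : ℝ) {q : ℕ} (hq : 2 ≤ q) :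
    Summable fun m : ℤ => ((x + m) ^ q)⁻¹ := by
  have h := (Real.summable_one_div_int_add_rpow x q).2 (by exact_mod_cast hq)
  refine Summable.of_norm (h.congr fun m => ?_)
  rw [Real.rpow_natCast, norm_inv, norm_pow, Real.norm_eq_abs, add_comm, one_div]

theorem summable_inv_int_pow {q : ℕ} (hq : 2 ≤ q) : Summable fun m : ℤ => ((m : ℝ) ^ q)⁻¹ := by
  simpa using summable_inv_add_int_pow 0 hq

theorem summable_inv_add_int_sub_inv (x : ℝ) (hx : ∀ m : ℤ, x + m ≠ 0) :
    Summable fun m : ℤ => (x + m)⁻¹ - (m : ℝ)⁻¹ := by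
  -- For `m ≠ 0` the difference is `-x / ((x + m) m)`, bounded by the sum of the two squares. The
  -- last summand covers `m = 0`, where `0⁻¹ = 0`.
  have h : Summable fun m : ℤ => |x| * (((x + m) ^ 2)⁻¹ + ((m : ℝ) ^ 2)⁻¹) + if m = 0 then |x⁻¹| else 0 :=
    (((summable_inv_add_int_pow x le_rfl).add (summable_inv_int_pow le_rfl)).mul_left _).add
      (summable_of_ne_finset_zero (s := {0}) (by intro b hb; simp at hb; simp [hb]))
  refine h.of_norm_bounded fun m => ?_
  by_cases hm : m = 0
  · subst hm
    simp only [Int.cast_zero, add_zero, inv_zero, sub_zero, if_true, Real.norm_eq_abs]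
    have : 0 ≤ |x| * ((x ^ 2)⁻¹ + ((0:ℝ) ^ 2)⁻¹) := by positivity
    linarith
  · have hm' : (m : ℝ) ≠ 0 := by exact_mod_cast hm
    have h1 := hx m
    rw [if_neg hm, add_zero, show (x + m)⁻¹ - (m : ℝ)⁻¹ = -(x * ((x + m)⁻¹ * (m : ℝ)⁻¹)) by
      field_simp; ring]
    rw [norm_neg, norm_mul, Real.norm_eq_abs, Real.norm_eq_abs]
    gcongr
    rw [← inv_pow, ← inv_pow, abs_le]
    constructor <;> nlinarith [sq_nonneg ((x + m)⁻¹ - (m : ℝ)⁻¹), sq_nonneg ((x + m)⁻¹ + (m : ℝ)⁻¹),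
      sq_nonneg ((x + m)⁻¹), sq_nonneg ((m : ℝ)⁻¹)]

theorem hasSum_eisen_one {x : ℝ} (hx : ∀ m : ℤ, x + m ≠ 0) :
    HasSum (fun m : ℤ => (x + m)⁻¹ - (m : ℝ)⁻¹) (eisen 1 x) := by
  have hsum := summable_inv_add_int_sub_inv x hx
  have hz : (x : ℂ) ∈ Complex.integerComplement := by
    rintro ⟨k, hk⟩
    have : (k : ℝ) = x := by exact_mod_cast hk
    exact hx (-k) (by push_cast; linarith)
  have hrep := cot_series_rep' hz
  have h3 : Real.pi * (Real.cos (Real.pi * x) / Real.sin (Real.pi * x)) - 1 / x =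
      ∑' n : ℕ, (1 / (x - (n + 1)) + 1 / (x + (n + 1))) := by
    apply Complex.ofReal_injective
    push_cast
    rw [← hrep, Complex.cot]
  have hn1 : Summable fun n : ℕ => (x + ((n + 1 : ℤ) : ℝ))⁻¹ - (((n + 1 : ℤ)) : ℝ)⁻¹ :=
    hsum.comp_injective (i := fun n : ℕ => ((n : ℤ) + 1)) (fun a b h => by simpa using h)
  have hn2 : Summable fun n : ℕ => (x + ((-(n + 1) : ℤ) : ℝ))⁻¹ - (((-(n + 1) : ℤ)) : ℝ)⁻¹ :=
    hsum.comp_injective (i := fun n : ℕ => (-((n : ℤ) + 1))) (fun a b h => by simpa using h)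
  have key := hn1.hasSum.of_add_one_of_neg_add_one (f := fun m : ℤ => (x + m)⁻¹ - (m : ℝ)⁻¹) hn2.hasSum
  convert! key using 1
  rw [eisen_one, add_right_comm, ← hn1.tsum_add hn2]
  rw [sub_eq_iff_eq_add] at h3
  rw [h3]
  congr 1
  · refine tsum_congr fun n => ?_
    push_cast
    simp only [one_div, ← sub_eq_add_neg, neg_add]
    have : (-(n:ℝ) - 1)⁻¹ = - ((n : ℝ) + 1)⁻¹ := by rw [← inv_neg]; ring
    rw [this]
    ring
  · simp

theorem abs_sin_pi_mul_add_int (x : ℝ) (m : ℤ) :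
    |Real.sin (Real.pi * (x + m))| = |Real.sin (Real.pi * x)| := by
  rw [mul_add, mul_comm Real.pi (m : ℝ), Real.sin_add_int_mul_pi, abs_mul, abs_zpow]
  simp

theorem abs_sin_le_pi_mul_abs_add_int (x : ℝ) (m : ℤ) :
    |Real.sin (Real.pi * x)| ≤ Real.pi * |x + m| := by
  rw [← abs_sin_pi_mul_add_int x m]
  refine Real.abs_sin_le_abs.trans ?_
  rw [abs_mul, abs_of_pos Real.pi_pos]

/-- Termwise differentiation. The constants `c m` disappear, so one lemma serves both the
regularized series at exponent 1 and the absolutely convergent ones after it. -/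
theorem hasSum_eisen_succ (q : ℕ) (c : ℤ → ℝ)
    (h : ∀ x : ℝ, (∀ m : ℤ, x + m ≠ 0) →
      HasSum (fun m : ℤ => ((x + m) ^ (q + 1))⁻¹ - c m) (eisen (q + 1) x))
    {x : ℝ} (hx : ∀ m : ℤ, x + m ≠ 0) :
    HasSum (fun m : ℤ => ((x + m) ^ (q + 2))⁻¹) (eisen (q + 2) x) := by
  have hs := sin_pi_mul_ne_zero hx
  obtain ⟨δ, hδ, hδx⟩ : ∃ δ > 0, ∀ m : ℤ, δ ≤ |x + m| := by
    refine ⟨|Real.sin (Real.pi * x)| / Real.pi, div_pos (abs_pos.2 hs) Real.pi_pos, fun m => ?_⟩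
    rw [div_le_iff₀' Real.pi_pos]
    exact abs_sin_le_pi_mul_abs_add_int x m
  -- Near `x` all denominators stay within a factor 2 of those at `x`, which gives a uniform
  -- summable majorant for the derivatives.
  have hball : ∀ y ∈ Metric.ball x (δ / 2), ∀ m : ℤ, |x + m| / 2 ≤ |y + m| := by
    intro y hy m
    rw [Metric.mem_ball, Real.dist_eq] at hy
    have h1 := hδx m
    have h2 : |x + m| ≤ |y + m| + |y - x| := by
      rw [show x + m = (y + m) - (y - x) by ring]
      exact abs_sub _ _
    linarith
  have hball0 : ∀ y ∈ Metric.ball x (δ / 2), ∀ m : ℤ, y + m ≠ 0 := by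
    intro y hy m h0
    have h1 := hball y hy m
    rw [h0, abs_zero] at h1
    linarith [hδx m]
  have hxm : x ∈ Metric.ball x (δ / 2) := Metric.mem_ball_self (by positivity)
  have hsum := (summable_inv_add_int_pow x (q := q + 2) (by omega))
  have hd := hasDerivAt_tsum_of_isPreconnected
    (g := fun (m : ℤ) (y : ℝ) => ((y + m) ^ (q + 1))⁻¹ - c m)
    (g' := fun (m : ℤ) (y : ℝ) => -(q + 1) * ((y + m) ^ (q + 2))⁻¹)
    (u := fun m : ℤ => (q + 1) * 2 ^ (q + 2) * ‖((x + m) ^ (q + 2))⁻¹‖)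
    (hsum.norm.mul_left _) Metric.isOpen_ball
    (convex_ball x (δ / 2)).isPreconnected ?_ ?_ hxm (h x hx).summable hxm
  · have h1 : (fun z : ℝ => ∑' m : ℤ, (((z + m) ^ (q + 1))⁻¹ - c m)) =ᶠ[nhds x] eisen (q + 1) := by
      filter_upwards [Metric.ball_mem_nhds x (half_pos hδ)] with y hy
      exact (h y (hball0 y hy)).tsum_eq
    have h2 := (hd.congr_of_eventuallyEq h1.symm).unique (hasDerivAt_eisen q hx)
    rw [tsum_mul_left] at h2
    have h3 : -((q : ℝ) + 1) ≠ 0 := by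
      have : (0 : ℝ) < q + 1 := by positivity
      linarith
    rw [← mul_left_cancel₀ h3 h2]
    exact hsum.hasSum
  · intro m y hy
    have h0 := hball0 y hy m
    have h1 : HasDerivAt (fun y : ℝ => (y + m) ^ (q + 1)) (((q + 1 : ℕ) : ℝ) * (y + m) ^ q * 1) y :=
      ((hasDerivAt_id y).add_const (m : ℝ)).pow (q + 1)
    convert! (h1.inv (pow_ne_zero _ h0)).sub_const (c m) using 1
    push_cast
    field_simp
    ring
  · intro m y hy
    have h1 := hball y hy m
    have h2 : 0 < |x + m| := hδ.trans_le (hδx m)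
    rw [norm_mul, norm_neg, norm_inv, norm_inv, norm_pow, norm_pow, Real.norm_eq_abs (y + m),
      Real.norm_eq_abs (x + m), Real.norm_eq_abs, abs_of_nonneg (by positivity), mul_assoc]
    gcongr
    have h3 : (2 : ℝ) ^ (q + 2) * (|x + m| ^ (q + 2))⁻¹ = ((|x + m| / 2) ^ (q + 2))⁻¹ := by
      rw [div_pow, inv_div, div_eq_mul_inv]
    rw [h3]
    gcongr

theorem hasSum_eisen (q : ℕ) {x : ℝ} (hx : ∀ m : ℤ, x + m ≠ 0) :
    HasSum (fun m : ℤ => ((x + m) ^ (q + 2))⁻¹) (eisen (q + 2) x) := by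
  induction q generalizing x with
  | zero =>
    exact hasSum_eisen_succ 0 (fun m => (m : ℝ)⁻¹)
      (fun y hy => by simpa using hasSum_eisen_one hy) hx
  | succ q ih =>
    exact hasSum_eisen_succ (q + 1) (fun _ => 0) (fun y hy => by simpa using ih hy) hx

/-- The sum `∑_{m ≠ 0} m^(-q)`, which is taken to be `0` for `q = 1`. -/
noncomputable def zetaInt (q : ℕ) : ℝ := if q = 1 then 0 else ∑' m : ℤ, ((m : ℝ) ^ q)⁻¹

theorem hasSum_zetaInt {q : ℕ} (hq : 2 ≤ q) :
    HasSum (fun m : ℤ => ((m : ℝ) ^ q)⁻¹) (zetaInt q) := by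
  rw [zetaInt, if_neg (by omega)]
  exact (summable_inv_int_pow hq).hasSum

theorem hasSum_eisen_sub {q : ℕ} (hq : 1 ≤ q) {x : ℝ} (hx : ∀ m : ℤ, x + m ≠ 0) :
    HasSum (fun m : ℤ => ((x + m) ^ q)⁻¹ - ((m : ℝ) ^ q)⁻¹) (eisen q x - zetaInt q) := by
  obtain rfl | hq := hq.eq_or_lt
  · simpa [zetaInt] using hasSum_eisen_one hx
  · obtain ⟨q, rfl⟩ := Nat.exists_eq_add_of_le' hq
    exact (hasSum_eisen q hx).sub (hasSum_zetaInt (by omega))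

/-! ### Weights of period 4 and rational multiples of `π^q`. -/

theorem hasSum_int_of_mod_four {F : ℤ → ℝ} {S : ZMod 4 → ℝ}
    (h : ∀ k : ZMod 4, HasSum (fun l : ℤ => F (4 * l + k.val)) (S k)) : HasSum F (∑ k, S k) := by
  have h1 : ∀ k : ZMod 4, HasSum (fun m : ℤ => if (m : ZMod 4) = k then F m else 0) (S k) := by
    intro k
    have hinj : Function.Injective fun l : ℤ => 4 * l + (k.val : ℤ) := fun a b hab => by
      simpa using hab
    refine (hinj.hasSum_iff ?_).1 ?_
    · intro m hm
      rw [if_neg]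
      intro hk
      apply hm
      rw [← hk]
      refine ⟨m / 4, ?_⟩
      simp only [ZMod.val_intCast]
      exact Int.mul_ediv_add_emod m 4
    · refine (h k).congr_fun ?_
      intro l
      have h4 : (4 : ZMod 4) = 0 := rfl
      simp [h4]
  refine (hasSum_sum (s := Finset.univ) fun k _ => h1 k).congr_fun ?_
  intro m
  simp

/-- The cotangent of `π k / 4` is `1, 0, -1` for `k = 1, 2, 3`. For `k = 0` the quotient is the
default value `0` of division by zero, not a sum of a series. -/
theorem exists_rat_eisen_div_four (q : ℕ) (k : ZMod 4) :
    ∃ r : ℚ, eisen q ((k.val : ℝ) / 4) = Real.pi ^ q * r := by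
  have key : ∀ c : ℚ, Real.cos (Real.pi * ((k.val : ℝ) / 4)) /
      Real.sin (Real.pi * ((k.val : ℝ) / 4)) = c →
      ∃ r : ℚ, eisen q ((k.val : ℝ) / 4) = Real.pi ^ q * r := by
    intro c hc
    refine ⟨Polynomial.aeval c (cotPoly q), ?_⟩
    rw [eisen, hc]
    congr 1
    have := Polynomial.aeval_algebraMap_apply ℝ c (cotPoly q)
    simpa using this
  have h2 : √(2 : ℝ) ≠ 0 := by positivity
  fin_cases k
  · apply key 0
    simp [ZMod.val]
  · apply key 1
    simp [ZMod.val]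
    rw [show Real.pi * 4⁻¹ = Real.pi / 4 by ring]
    simp
  · apply key 0
    simp [ZMod.val]
    rw [show Real.pi * (2 / 4) = Real.pi / 2 by ring]
    simp
  · apply key (-1)
    simp [ZMod.val]
    rw [show Real.pi * (3 / 4) = Real.pi - Real.pi / 4 by ring, Real.cos_pi_sub, Real.sin_pi_sub]
    simp

theorem zmodVal_div_four_add_ne_zero {k : ZMod 4} (hk : k ≠ 0) (m : ℤ) :
    (k.val : ℝ) / 4 + m ≠ 0 := by
  intro h
  have h1 : (k.val : ℤ) + 4 * m = 0 := by
    have : (k.val : ℝ) + 4 * m = 0 := by linarith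
    exact_mod_cast this
  have h2 := ZMod.val_lt k
  have h3 := (ZMod.val_ne_zero k).2 hk
  omega

/-- Splitting modulo 4 gives `4^q Z = Z + ∑_{k ≠ 0} eisen q (k / 4)` for the sum `Z`, and this can
be solved for `Z`. -/
theorem exists_rat_zetaInt {q : ℕ} (hq : 1 ≤ q) : ∃ r : ℚ, zetaInt q = Real.pi ^ q * r := by
  obtain rfl | hq := hq.eq_or_lt
  · exact ⟨0, by simp [zetaInt]⟩
  choose r hr using exists_rat_eisen_div_four q
  have h1 := hasSum_int_of_mod_four (F := fun m : ℤ => ((m : ℝ) ^ q)⁻¹)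
    (S := fun k : ZMod 4 => (4 ^ q)⁻¹ * (if k = 0 then zetaInt q else eisen q (k.val / 4))) ?_
  · have h2 := h1.unique (hasSum_zetaInt hq)
    rw [← Finset.mul_sum, Finset.sum_ite, Finset.filter_eq' Finset.univ 0] at h2
    simp only [Finset.mem_univ, if_true, Finset.sum_singleton, hr, ← Finset.mul_sum] at h2
    have h4 : (4 : ℝ) ^ q ≠ 0 := by positivity
    have h5 : (4 : ℝ) ^ q - 1 ≠ 0 := by
      have : (1 : ℝ) < 4 ^ q := one_lt_pow₀ (by norm_num) (by omega)
      linarith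
    refine ⟨(∑ k : ZMod 4 with ¬ k = 0, r k) / (4 ^ q - 1), ?_⟩
    push_cast
    field_simp at h2 ⊢
    linarith
  · intro k
    split_ifs with hk
    · subst hk
      refine ((hasSum_zetaInt hq).mul_left _).congr_fun fun l => ?_
      simp [mul_pow, mul_comm]
    · obtain ⟨q, rfl⟩ := Nat.exists_eq_add_of_le' hq
      refine ((hasSum_eisen q (zmodVal_div_four_add_ne_zero hk)).mul_left _).congr_fun fun l => ?_
      rw [← mul_inv, ← mul_pow]
      congr 2
      push_cast
      ring

/-- The closed form of `∑ₘ h(m) (x + m)^(-q)` for a weight `h` of period `4`. -/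
noncomputable def wEisen (h : ZMod 4 → ℚ) (q : ℕ) (x : ℝ) : ℝ :=
  ∑ k : ZMod 4, (h k : ℝ) * ((4 ^ q)⁻¹ * eisen q ((x + k.val) / 4))

/-- The constant subtracted by the regularization is the weighted zeta value whenever the latter
converges. Hence a single `r` serves both clauses. -/
theorem exists_rat_hasSum_wEisen (h : ZMod 4 → ℚ) {q : ℕ} (hq : 1 ≤ q) :
    ∃ r : ℚ, (∀ x : ℝ, (∀ m : ℤ, x + m ≠ 0) →
      HasSum (fun m : ℤ => (h m : ℝ) * (((x + m) ^ q)⁻¹ - ((m : ℝ) ^ q)⁻¹))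
        (wEisen h q x - Real.pi ^ q * r)) ∧
      (2 ≤ q → HasSum (fun m : ℤ => (h m : ℝ) * ((m : ℝ) ^ q)⁻¹) (Real.pi ^ q * r)) := by
  choose r hr using exists_rat_eisen_div_four q
  obtain ⟨z, hz⟩ := exists_rat_zetaInt hq
  refine ⟨∑ k : ZMod 4, h k * ((4 ^ q)⁻¹ * (if k = 0 then z else r k)), fun x hx => ?_, fun hq => ?_⟩
  · have h1 := hasSum_int_of_mod_four
      (F := fun m : ℤ => (h m : ℝ) * (((x + m) ^ q)⁻¹ - ((m : ℝ) ^ q)⁻¹))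
      (S := fun k : ZMod 4 => (h k : ℝ) * ((4 ^ q)⁻¹ * (eisen q ((x + k.val) / 4) -
        Real.pi ^ q * (if k = 0 then z else r k)))) ?_
    · convert! h1 using 1
      rw [wEisen]
      push_cast
      rw [Finset.mul_sum, ← Finset.sum_sub_distrib]
      refine Finset.sum_congr rfl fun k _ => ?_
      split_ifs <;> ring
    · intro k
      have hxk : ∀ m : ℤ, (x + k.val) / 4 + m ≠ 0 := by
        intro m h0
        apply hx (k.val + 4 * m)
        push_cast
        linarith
      have h4 : (4 : ZMod 4) = 0 := rfl
      have h2 := hasSum_eisen_sub hq hxk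
      have h3 : HasSum (fun m : ℤ => (((x + k.val) / 4 + m) ^ q)⁻¹ - (((k.val : ℝ) / 4 + m) ^ q)⁻¹)
          (eisen q ((x + k.val) / 4) - Real.pi ^ q * (if k = 0 then z else r k)) := by
        split_ifs with hk
        · subst hk
          simpa [hz] using h2
        -- Subtracting the series at `k / 4` replaces the regularizing terms `m^(-q)` by `(k/4 +
        -- m)^(-q)`, as the residue class of `k` requires.
        · have := h2.sub (hasSum_eisen_sub hq (zmodVal_div_four_add_ne_zero hk))
          rw [hr] at this
          convert! this using 1
          · ext m
            ring
          · ring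
      refine ((h3.mul_left _).mul_left _).congr_fun fun l => ?_
      rw [mul_sub (((4 : ℝ) ^ q)⁻¹), ← mul_inv, ← mul_pow, ← mul_inv, ← mul_pow]
      push_cast
      rw [h4]
      simp only [zero_mul, zero_add, ZMod.natCast_val, ZMod.cast_id', id_eq]
      congr 4 <;> ring
  · have h1 := hasSum_int_of_mod_four
      (F := fun m : ℤ => (h m : ℝ) * ((m : ℝ) ^ q)⁻¹)
      (S := fun k : ZMod 4 => (h k : ℝ) * ((4 ^ q)⁻¹ * (Real.pi ^ q * (if k = 0 then z else r k)))) ?_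
    · convert! h1 using 1
      push_cast
      rw [Finset.mul_sum]
      refine Finset.sum_congr rfl fun k _ => ?_
      split_ifs <;> ring
    · intro k
      have h4 : (4 : ZMod 4) = 0 := rfl
      have h3 : HasSum (fun m : ℤ => (((k.val : ℝ) / 4 + m) ^ q)⁻¹)
          (Real.pi ^ q * (if k = 0 then z else r k)) := by
        split_ifs with hk
        · subst hk
          simpa [← hz] using hasSum_zetaInt hq
        · rw [← hr]
          obtain ⟨q, rfl⟩ := Nat.exists_eq_add_of_le' hq
          exact hasSum_eisen q (zmodVal_div_four_add_ne_zero hk)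
      refine ((h3.mul_left _).mul_left _).congr_fun fun l => ?_
      rw [← mul_inv, ← mul_pow]
      push_cast
      rw [h4]
      simp only [zero_mul, zero_add, ZMod.natCast_val, ZMod.cast_id', id_eq]
      congr 3
      ring

theorem eisen_div_four_congr (q : ℕ) (x : ℝ) {a b : ℤ} (hab : (a : ZMod 4) = b) :
    eisen q ((x + a) / 4) = eisen q ((x + b) / 4) := by
  obtain ⟨c, hc⟩ := (ZMod.intCast_eq_intCast_iff_dvd_sub a b 4).1 hab
  rw [← eisen_add_int q ((x + a) / 4) c]
  congr 1
  have : (b : ℝ) - a = 4 * c := by exact_mod_cast hc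
  linarith

theorem wEisen_add_int (h : ZMod 4 → ℚ) (q : ℕ) (x : ℝ) (k : ℤ) :
    wEisen h q (x + k) = wEisen (fun m => h (m - k)) q x := by
  rw [wEisen, wEisen, ← Equiv.sum_comp (Equiv.subRight (k : ZMod 4))]
  refine Finset.sum_congr rfl fun m _ => ?_
  simp only [Equiv.subRight_apply]
  congr 2
  have := eisen_div_four_congr q x (a := k + ((m - (k : ZMod 4)).val : ℤ)) (b := (m.val : ℤ))
    (by simp)
  push_cast at this
  rw [← this, add_assoc]

/-! ### Badly approximable numbers and convergence of the outer sum. -/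

/-- `τ` is badly approximable: `|n| * |n τ + m|` is bounded below for `n ≠ 0`. -/
def BadlyApproximable (τ : ℝ) : Prop :=
  ∃ κ > 0, ∀ n m : ℤ, n ≠ 0 → κ ≤ |(n : ℝ)| * |n * τ + m|

theorem BadlyApproximable.mul_add_ne_zero {τ : ℝ} (h : BadlyApproximable τ) {n : ℤ} (hn : n ≠ 0)
    (m : ℤ) : n * τ + m ≠ 0 := by
  obtain ⟨κ, hκ, h⟩ := h
  intro h0
  have := h n m hn
  rw [h0, abs_zero, mul_zero] at this
  linarith

theorem BadlyApproximable.ne_zero {τ : ℝ} (h : BadlyApproximable τ) : τ ≠ 0 := by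
  simpa using h.mul_add_ne_zero one_ne_zero 0

/-- Allows a sum over separated reals to be compared with a sum over their integer parts. The factor
`1/3` is forced by `y` slightly below `-1`, where the floor is `-2`. -/
theorem mul_abs_floor_add_one_le {y δ : ℝ} (hδ : 0 < δ) (hδ1 : δ ≤ 1) (hy : δ ≤ |y|) :
    δ / 3 * (|(⌊y⌋ : ℝ)| + 1) ≤ |y| := by
  have h1 := Int.floor_le y
  have h2 := Int.lt_floor_add_one y
  rcases lt_trichotomy ⌊y⌋ 0 with h | h | h
  · have h3 : (⌊y⌋ : ℝ) + 1 ≤ 0 := by exact_mod_cast h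
    rw [abs_of_nonpos (a := (⌊y⌋ : ℝ)) (by linarith)]
    have h4 : |y| = -y := abs_of_nonpos (by linarith)
    rw [h4] at hy ⊢
    rcases (show ⌊y⌋ ≤ -1 by omega).eq_or_lt with h5 | h5
    · rw [h5]; push_cast; linarith
    · have h6 : (⌊y⌋ : ℝ) ≤ -2 := by exact_mod_cast (show ⌊y⌋ ≤ -2 by omega)
      nlinarith
  · rw [h]; simp; linarith
  · have h3 : (1 : ℝ) ≤ ⌊y⌋ := by exact_mod_cast h
    rw [abs_of_nonneg (a := (⌊y⌋ : ℝ)) (by linarith), abs_of_nonneg (a := y) (by linarith)]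
    nlinarith

theorem summable_abs_int_add_one_rpow :
    Summable fun i : ℤ => (|(i : ℝ)| + 1) ^ (-(3 / 2) : ℝ) := by
  have h : Summable fun n : ℕ => ((n : ℝ) + 1) ^ (-(3 / 2) : ℝ) := by
    have := (summable_nat_add_iff 1).2 (Real.summable_nat_rpow.2 (show (-(3 / 2) : ℝ) < -1 by norm_num))
    simpa using this
  refine Summable.of_nat_of_neg ?_ ?_ <;> simpa using h

theorem two_mul_abs_sub_round_le_abs_sin (x : ℝ) :
    2 * |x - round x| ≤ |Real.sin (Real.pi * x)| := by
  have h := Real.mul_abs_le_abs_sin (x := Real.pi * (x - round x)) ?_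
  · have h2 := abs_sin_pi_mul_add_int x (-round x)
    push_cast at h2
    rw [← sub_eq_add_neg] at h2
    rw [h2, abs_mul, abs_of_pos Real.pi_pos] at h
    have := Real.pi_pos
    calc _ = 2 / Real.pi * (Real.pi * |x - round x|) := by field_simp
      _ ≤ _ := h
  · rw [abs_mul, abs_of_pos Real.pi_pos]
    have := abs_sub_round x
    nlinarith [Real.pi_pos]

theorem rpow_neg_three_halves_anti {a b : ℝ} (ha : 0 < a) (hab : a ≤ b) :
    b ^ (-(3 / 2) : ℝ) ≤ a ^ (-(3 / 2) : ℝ) :=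
  Real.rpow_le_rpow_of_nonpos ha hab (by norm_num)

/-- Within a dyadic block `2^k ≤ n < 2^(k+1)` the signed distances `x n` of `nτ` to the nearest
integer are `κ / 2^(k+1)`-separated and at least that far from `0`. Rescaled to unit spacing they
become `y n`, and the sum is dominated by one over pairs (block, integer part). -/
theorem summable_nat_inv_sq_mul_inv_sin {τ : ℝ} (hτ : BadlyApproximable τ) :
    Summable fun n : ℕ => ((n : ℝ) ^ 2)⁻¹ * |Real.sin (Real.pi * (n * τ))|⁻¹ := by
  obtain ⟨κ, hκ, h⟩ := hτ
  set x : ℕ → ℝ := fun n => (n + 1 : ℕ) * τ - round ((n + 1 : ℕ) * τ) with hx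
  set k : ℕ → ℕ := fun n => Nat.log 2 (n + 1) with hk
  set y : ℕ → ℝ := fun n => x n * 2 ^ (k n + 1) / κ with hy
  have hk1 : ∀ n, (2 : ℝ) ^ k n ≤ (n + 1 : ℕ) := fun n => by
    exact_mod_cast Nat.pow_log_le_self 2 (Nat.succ_ne_zero n)
  have hk2 : ∀ n, ((n + 1 : ℕ) : ℝ) < 2 ^ (k n + 1) := fun n => by
    exact_mod_cast Nat.lt_pow_succ_log_self (by norm_num) _
  have hxκ : ∀ n, κ ≤ ((n + 1 : ℕ) : ℝ) * |x n| := fun n => by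
    have := h (n + 1 : ℕ) (-round (((n + 1 : ℕ) : ℝ) * τ)) (by omega)
    push_cast at this ⊢
    rw [abs_of_nonneg (a := (n : ℝ) + 1) (by positivity)] at this
    simpa [hx, ← sub_eq_add_neg] using this
  have hx0 : ∀ n, 0 < |x n| := fun n => by
    by_contra h0
    have h1 : |x n| = 0 := le_antisymm (not_lt.1 h0) (abs_nonneg _)
    have := hxκ n
    rw [h1, mul_zero] at this
    linarith
  have hyabs : ∀ n, |y n| = |x n| * 2 ^ (k n + 1) / κ := fun n => by
    rw [hy, abs_div, abs_mul, abs_of_pos hκ, abs_of_pos (a := (2 : ℝ) ^ _) (by positivity)]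
  have hy1 : ∀ n, 1 ≤ |y n| := fun n => by
    rw [hyabs, le_div_iff₀ hκ, one_mul]
    have := hxκ n
    have := hk2 n
    nlinarith [hx0 n]
  -- Two indices in one block differ by at most `2^(k+1)`, so bad approximability of the difference
  -- keeps their `y` at distance at least 1.
  have hinj : Function.Injective fun n => (k n, ⌊y n⌋) := by
    intro a b hab
    by_contra hne
    obtain ⟨h1, h2⟩ := Prod.mk.injEq .. ▸ hab
    have h3 : |y a - y b| < 1 := Int.abs_sub_lt_one_of_floor_eq_floor h2
    have h4 : y a - y b = (x a - x b) * 2 ^ (k a + 1) / κ := by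
      simp only [hy]; rw [← h1]; ring
    rw [h4, abs_div, abs_mul, abs_of_pos hκ, abs_of_pos (a := (2 : ℝ) ^ _) (by positivity),
      div_lt_one hκ] at h3
    have h5 := h ((a : ℤ) - b) (round (((b + 1 : ℕ) : ℝ) * τ) - round (((a + 1 : ℕ) : ℝ) * τ))
      (by omega)
    have h6 : (((a : ℤ) - b : ℤ) : ℝ) * τ + ((round (((b + 1 : ℕ) : ℝ) * τ) -
        round (((a + 1 : ℕ) : ℝ) * τ) : ℤ) : ℝ) = x a - x b := by
      simp only [hx]; push_cast; ring
    rw [h6] at h5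
    have h7 : |(((a : ℤ) - b : ℤ) : ℝ)| ≤ 2 ^ (k a + 1) := by
      have ha := hk2 a
      have hb := hk2 b
      rw [← h1] at hb
      push_cast at ha hb ⊢
      rw [abs_le]
      constructor <;> linarith [Nat.cast_nonneg (α := ℝ) a, Nat.cast_nonneg (α := ℝ) b]
    nlinarith [abs_nonneg (x a - x b)]
  rw [← summable_nat_add_iff 1]
  have hg : Summable fun k : ℕ => ((√2)⁻¹ : ℝ) ^ k := by
    apply summable_geometric_of_lt_one (by positivity)
    rw [inv_lt_one₀ (by positivity)]
    exact Real.lt_sqrt_of_sq_lt (by norm_num)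
  have hmain := (hg.mul_of_nonneg summable_abs_int_add_one_rpow
    (fun k => by positivity) (fun i => by positivity)).comp_injective hinj
  refine Summable.of_nonneg_of_le (fun n => by positivity) (fun n => ?_)
    (hmain.mul_left (κ⁻¹ * (κ⁻¹) ^ (1 / 2 : ℝ) * (3⁻¹ : ℝ) ^ (-(3 / 2) : ℝ)))
  have hsin : 2 * |x n| ≤ |Real.sin (Real.pi * ((n + 1 : ℕ) * τ))| :=
    two_mul_abs_sub_round_le_abs_sin _
  have hypos : 0 < |y n| := by linarith [hy1 n]
  have hyle : |y n| ≤ 2 ^ k n * κ⁻¹ := by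
    rw [hyabs, div_eq_mul_inv, pow_succ]
    have : |x n| ≤ 1 / 2 := abs_sub_round _
    have : |x n| * (2 ^ k n * 2) ≤ 2 ^ k n := by
      nlinarith [show (0 : ℝ) < 2 ^ k n by positivity]
    gcongr
  have hyfl := mul_abs_floor_add_one_le one_pos le_rfl (hy1 n)
  -- The exponent `-3/2` makes the sum over integer parts converge; the remaining `|y n|^(1/2)`
  -- costs only `√2^k` out of the available `2^(-k)`.
  have e1 : |y n|⁻¹ = |y n| ^ (1 / 2 : ℝ) * |y n| ^ (-(3 / 2) : ℝ) := by
    rw [← Real.rpow_add hypos, ← Real.rpow_neg_one]; norm_num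
  have e2 : |y n| ^ (1 / 2 : ℝ) ≤ (√2) ^ k n * (κ⁻¹) ^ (1 / 2 : ℝ) := by
    calc _ ≤ (2 ^ k n * κ⁻¹) ^ (1 / 2 : ℝ) := by gcongr
      _ = _ := by
        rw [Real.mul_rpow (by positivity) (by positivity), Real.sqrt_eq_rpow,
          ← Real.rpow_natCast, ← Real.rpow_natCast, ← Real.rpow_mul (by norm_num),
          ← Real.rpow_mul (by norm_num), mul_comm (1 / 2 : ℝ)]
  have e3 : |y n| ^ (-(3 / 2) : ℝ) ≤
      (3⁻¹ : ℝ) ^ (-(3 / 2) : ℝ) * (|(⌊y n⌋ : ℝ)| + 1) ^ (-(3 / 2) : ℝ) := by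
    rw [← Real.mul_rpow (by positivity) (by positivity)]
    apply rpow_neg_three_halves_anti (by positivity)
    rw [one_div] at hyfl
    exact hyfl
  have e4 : (((n + 1 : ℕ) : ℝ) ^ 2)⁻¹ ≤ ((2 ^ k n) ^ 2)⁻¹ := by
    gcongr
    exact hk1 n
  have e5 : |Real.sin (Real.pi * ((n + 1 : ℕ) * τ))|⁻¹ ≤ 2 ^ k n * κ⁻¹ * |y n|⁻¹ := by
    calc _ ≤ (2 * |x n|)⁻¹ := inv_anti₀ (by linarith [hx0 n]) hsin
      _ = _ := by
        rw [hyabs]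
        have := hx0 n
        field_simp
        ring
  have hs2 : (√2 : ℝ) ^ k n * (√2) ^ k n = 2 ^ k n := by
    rw [← mul_pow, Real.mul_self_sqrt (by norm_num)]
  calc _ ≤ ((2 ^ k n) ^ 2)⁻¹ * (2 ^ k n * κ⁻¹ * |y n|⁻¹) := by gcongr
    _ = ((2 : ℝ) ^ k n)⁻¹ * κ⁻¹ * (|y n| ^ (1 / 2 : ℝ) * |y n| ^ (-(3 / 2) : ℝ)) := by
      rw [e1]; field_simp
    _ ≤ ((2 : ℝ) ^ k n)⁻¹ * κ⁻¹ * (((√2) ^ k n * (κ⁻¹) ^ (1 / 2 : ℝ)) *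
        ((3⁻¹ : ℝ) ^ (-(3 / 2) : ℝ) * (|(⌊y n⌋ : ℝ)| + 1) ^ (-(3 / 2) : ℝ))) := by gcongr
    _ = _ := by
      rw [← hs2]
      simp only [Function.comp_apply, inv_pow]
      have : (√2 : ℝ) ^ k n ≠ 0 := by positivity
      field_simp

theorem summable_int_inv_sq_mul_inv_sin {τ : ℝ} (hτ : BadlyApproximable τ) :
    Summable fun n : ℤ => ((n : ℝ) ^ 2)⁻¹ * |Real.sin (Real.pi * (n * τ))|⁻¹ := by
  have h := summable_nat_inv_sq_mul_inv_sin hτ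
  refine Summable.of_nat_of_neg (by simpa using h) (by simpa using h)

theorem BadlyApproximable.exists_le_abs_sin {τ : ℝ} (hτ : BadlyApproximable τ) :
    ∃ κ > 0, ∀ n : ℤ, n ≠ 0 → κ ≤ |(n : ℝ)| * |Real.sin (Real.pi * (n * τ))| := by
  obtain ⟨κ, hκ, h⟩ := hτ
  refine ⟨κ, hκ, fun n hn => (h n (-round (n * τ)) hn).trans ?_⟩
  have := two_mul_abs_sub_round_le_abs_sin (n * τ)
  push_cast
  rw [← sub_eq_add_neg]
  refine mul_le_mul_of_nonneg_left ?_ (abs_nonneg _)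
  linarith [abs_nonneg ((n : ℝ) * τ - round ((n : ℝ) * τ))]

/-- Since `|n| |sin (π n τ)|` is bounded below, all but one factor of the inverse sine can be traded
for a power of `n`. -/
theorem summable_inv_pow_mul_inv_sin_pow {τ : ℝ} (hτ : BadlyApproximable τ) {p q : ℕ}
    (hq : 1 ≤ q) (hpq : q + 1 ≤ p) :
    Summable fun n : ℤ => (|(n : ℝ)| ^ p)⁻¹ * (|Real.sin (Real.pi * (n * τ))| ^ q)⁻¹ := by
  obtain ⟨κ, hκ, h⟩ := hτ.exists_le_abs_sin
  refine Summable.of_nonneg_of_le (fun n => by positivity) (fun n => ?_)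
    ((summable_int_inv_sq_mul_inv_sin hτ).mul_left ((κ⁻¹) ^ (q - 1)))
  obtain ⟨q, rfl⟩ := Nat.exists_eq_add_of_le' hq
  obtain ⟨d, rfl⟩ := Nat.exists_eq_add_of_le hpq
  rcases eq_or_ne n 0 with rfl | hn
  · simp
  · have hn1 : (1 : ℝ) ≤ |(n : ℝ)| := by exact_mod_cast Int.one_le_abs hn
    set s := |Real.sin (Real.pi * (n * τ))|
    have h1 := h n hn
    calc (|(n : ℝ)| ^ (q + 1 + 1 + d))⁻¹ * (s ^ (q + 1))⁻¹
        = ((|(n : ℝ)| * s)⁻¹) ^ q * (|(n : ℝ)| ^ (2 + d))⁻¹ * s⁻¹ := by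
          rw [← inv_pow, ← inv_pow, ← inv_pow, mul_inv]; ring
      _ ≤ (κ⁻¹) ^ q * (|(n : ℝ)| ^ 2)⁻¹ * s⁻¹ := by
          gcongr
          omega
      _ = _ := by rw [sq_abs, Nat.add_sub_cancel]; ring

theorem exists_abs_wEisen_le (q : ℕ) : ∃ C : ℝ, 0 ≤ C ∧ ∀ (h : ZMod 4 → ℚ) (x : ℝ),
    Real.sin (Real.pi * x) ≠ 0 →
    |wEisen h q x| ≤ (∑ k, |(h k : ℝ)|) * (C * (|Real.sin (Real.pi * x)| ^ q)⁻¹) := by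
  obtain ⟨C, hC⟩ := exists_abs_eisen_le q
  refine ⟨|C|, abs_nonneg C, fun h x hx => ?_⟩
  have hpos : 0 < |Real.sin (Real.pi * x)| := abs_pos.2 hx
  rw [wEisen, Finset.sum_mul]
  refine (Finset.abs_sum_le_sum_abs _ _).trans (Finset.sum_le_sum fun k _ => ?_)
  rw [abs_mul, abs_mul, abs_of_pos (a := ((4 : ℝ) ^ q)⁻¹) (by positivity)]
  refine mul_le_mul_of_nonneg_left ?_ (abs_nonneg _)
  set θ := Real.pi * ((x + k.val) / 4) with hθ
  -- Up to sign, `sin (π x)` is `sin (4θ)`; two duplications give the factor 4, which the weight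
  -- `4^(-q)` in `wEisen` absorbs.
  have h4 : |Real.sin (Real.pi * x)| ≤ 4 * |Real.sin θ| := by
    have h1 := abs_sin_pi_mul_add_int x (k.val : ℤ)
    push_cast at h1
    rw [← h1, show Real.pi * (x + k.val) = 2 * (2 * θ) by rw [hθ]; ring, Real.sin_two_mul,
      Real.sin_two_mul, abs_mul, abs_mul, abs_mul, abs_mul]
    have h2 := Real.abs_cos_le_one θ
    have h3 := Real.abs_cos_le_one (2 * θ)
    rw [abs_two]
    calc 2 * (2 * |Real.sin θ| * |Real.cos θ|) * |Real.cos (2 * θ)|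
        ≤ 2 * (2 * |Real.sin θ| * 1) * 1 := by gcongr
      _ = _ := by ring
  have hθ0 : 0 < |Real.sin θ| := by linarith
  have h5 := hC ((x + k.val) / 4) (abs_pos.1 hθ0)
  calc (4 ^ q)⁻¹ * |eisen q ((x + k.val) / 4)|
      ≤ (4 ^ q)⁻¹ * (|C| * (|Real.sin θ| ^ q)⁻¹) := by
        gcongr
        refine h5.trans ?_
        gcongr
        exact le_abs_self C
    _ = |C| * ((4 * |Real.sin θ|) ^ q)⁻¹ := by rw [mul_pow, mul_inv]; ring
    _ ≤ _ := by gcongr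

theorem summable_inv_pow_mul_wEisen {τ : ℝ} (hτ : BadlyApproximable τ) (f : ZMod 4 → ZMod 4 → ℚ)
    {p q : ℕ} (hq : 1 ≤ q) (hpq : q + 1 ≤ p) :
    Summable fun n : ℤ => ((n : ℝ) ^ p)⁻¹ * wEisen (f n) q (n * τ) := by
  obtain ⟨C, hC0, hC⟩ := exists_abs_wEisen_le q
  refine ((summable_inv_pow_mul_inv_sin_pow hτ hq hpq).mul_left
    ((∑ a, ∑ k, |(f a k : ℝ)|) * C)).of_norm_bounded fun n => ?_
  rcases eq_or_ne n 0 with rfl | hn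
  · simp [show p ≠ 0 by omega]
  · have hs := sin_pi_mul_ne_zero (hτ.mul_add_ne_zero hn)
    rw [norm_mul, norm_inv, norm_pow, Real.norm_eq_abs, Real.norm_eq_abs]
    have h1 := hC (f n) _ hs
    have h2 : ∑ k, |(f n k : ℝ)| ≤ ∑ a, ∑ k, |(f a k : ℝ)| :=
      Finset.single_le_sum (f := fun a => ∑ k, |(f a k : ℝ)|)
        (fun a _ => Finset.sum_nonneg fun k _ => abs_nonneg _) (Finset.mem_univ _)
    calc _ ≤ (|(n : ℝ)| ^ p)⁻¹ * ((∑ a, ∑ k, |(f a k : ℝ)|) *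
          (C * (|Real.sin (Real.pi * (n * τ))| ^ q)⁻¹)) := by
          gcongr
          refine h1.trans ?_
          gcongr
      _ = _ := by ring

/-! ### Absolute convergence of the double series behind inversion. -/

theorem inv_mul_three_le {x y z : ℝ} (hx : 0 < x) (hy : 0 < y) (hxz : x ≤ z) (hyz : y ≤ z) :
    (x * y * z)⁻¹ ≤ x ^ (-(3 / 2) : ℝ) * y ^ (-(3 / 2) : ℝ) := by
  have hz : 0 < z := hx.trans_le hxz
  have h1 : (x * y) ^ (1 / 2 : ℝ) ≤ z := by
    rw [← Real.sqrt_eq_rpow]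
    exact Real.sqrt_le_iff.2 ⟨hz.le, by nlinarith⟩
  rw [← Real.mul_rpow hx.le hy.le, Real.rpow_neg (by positivity)]
  apply inv_anti₀ (by positivity)
  calc (x * y) ^ (3 / 2 : ℝ) = (x * y) * (x * y) ^ (1 / 2 : ℝ) := by
        rw [show (3 / 2 : ℝ) = 1 + 1 / 2 by norm_num, Real.rpow_add (by positivity), Real.rpow_one]
    _ ≤ _ := by gcongr

/-- The largest of the three numbers is at least the geometric mean of the other two. Adding the
three possible bounds avoids distinguishing which is largest. -/
theorem inv_mul_three_le_add {x y z : ℝ} (hx : 0 < x) (hy : 0 < y) (hz : 0 < z) :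
    (x * y * z)⁻¹ ≤ x ^ (-(3 / 2) : ℝ) * y ^ (-(3 / 2) : ℝ) +
      x ^ (-(3 / 2) : ℝ) * z ^ (-(3 / 2) : ℝ) + y ^ (-(3 / 2) : ℝ) * z ^ (-(3 / 2) : ℝ) := by
  have hxy : 0 < x ^ (-(3 / 2) : ℝ) * y ^ (-(3 / 2) : ℝ) := by positivity
  have hxz : 0 < x ^ (-(3 / 2) : ℝ) * z ^ (-(3 / 2) : ℝ) := by positivity
  have hyz : 0 < y ^ (-(3 / 2) : ℝ) * z ^ (-(3 / 2) : ℝ) := by positivity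
  by_cases h1 : x ≤ z ∧ y ≤ z
  · have := inv_mul_three_le hx hy h1.1 h1.2
    linarith
  · by_cases h2 : x ≤ y ∧ z ≤ y
    · have := inv_mul_three_le hx hz h2.1 h2.2
      rw [mul_right_comm] at this
      linarith
    · have := inv_mul_three_le hy hz (z := x) (by grind) (by grind)
      rw [show y * z * x = x * y * z by ring] at this
      linarith

theorem summable_comp_rpow_mul_rpow {g : ℤ × ℤ → ℤ × ℤ} (hg : Function.Injective g) :
    Summable fun v : ℤ × ℤ =>
      (|((g v).1 : ℝ)| + 1) ^ (-(3 / 2) : ℝ) * (|((g v).2 : ℝ)| + 1) ^ (-(3 / 2) : ℝ) :=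
  (summable_abs_int_add_one_rpow.mul_of_nonneg summable_abs_int_add_one_rpow
    (fun i => by positivity) (fun i => by positivity)).comp_injective hg

theorem exists_rpow_neg_le_of_le {c : ℝ} (hc : 0 < c) : ∃ C, 0 ≤ C ∧ ∀ u x : ℝ, 0 < u → c * u ≤ x →
    x ^ (-(3 / 2) : ℝ) ≤ C * u ^ (-(3 / 2) : ℝ) := by
  refine ⟨c ^ (-(3 / 2) : ℝ), by positivity, fun u x hu hx => ?_⟩
  rw [← Real.mul_rpow hc.le hu.le]
  exact rpow_neg_three_halves_anti (by positivity) hx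

/-- Any two of `m`, `n`, `nτ + m` are comparable, after taking integer parts, to the coordinates of
an injective image of `(n, m)`. Each of the three products of `-3/2` powers is therefore summable
over `ℤ × ℤ`. -/
theorem summable_inv_mul_three_of_le {τ δ : ℝ} (hτ : τ ≠ 0) (hδ : 0 < δ) (hδ1 : δ ≤ 1) :
    Summable fun v : ℤ × ℤ => if v.1 ≠ 0 ∧ v.2 ≠ 0 ∧ δ ≤ |v.1 * τ + v.2| then
      (|(v.2 : ℝ)| * |(v.1 : ℝ)| * |v.1 * τ + v.2|)⁻¹ else 0 := by
  have hτ' : 0 < |τ| := abs_pos.2 hτ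
  obtain ⟨C₁, hC₁0, hC₁⟩ := exists_rpow_neg_le_of_le (c := 1 / 2) (by norm_num)
  obtain ⟨C₂, hC₂0, hC₂⟩ := exists_rpow_neg_le_of_le (c := δ / 3) (by positivity)
  -- The lower bound for `m/τ + n = (nτ + m)/τ`, capped at 1 as the floor estimate requires.
  set η := min 1 (δ / |τ|) with hη
  have hη0 : 0 < η := lt_min one_pos (by positivity)
  obtain ⟨C₃, hC₃0, hC₃⟩ := exists_rpow_neg_le_of_le (c := |τ| * (η / 3)) (by positivity)
  have s1 := (summable_comp_rpow_mul_rpow (g := fun v => (v.2, v.1)) Prod.swap_injective).mul_left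
    (C₁ * C₁)
  have s2 := (summable_comp_rpow_mul_rpow (g := fun v => (v.2, v.1 + ⌊(v.2 : ℝ) / τ⌋))
    (by rintro ⟨a, b⟩ ⟨c, d⟩ h; simp at h; obtain ⟨rfl, h⟩ := h; simpa using h)).mul_left (C₁ * C₃)
  have s3 := (summable_comp_rpow_mul_rpow (g := fun v => (v.1, v.2 + ⌊(v.1 : ℝ) * τ⌋))
    (by rintro ⟨a, b⟩ ⟨c, d⟩ h; simp at h; obtain ⟨rfl, h⟩ := h; simpa using h)).mul_left (C₁ * C₂)
  refine Summable.of_nonneg_of_le (fun v => by positivity) (fun v => ?_) ((s1.add s2).add s3)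
  obtain ⟨n, m⟩ := v
  split_ifs with h
  · obtain ⟨hn, hm, hX⟩ := h
    simp only at hn hm hX ⊢
    have hn1 : (1 : ℝ) ≤ |(n : ℝ)| := by exact_mod_cast Int.one_le_abs hn
    have hm1 : (1 : ℝ) ≤ |(m : ℝ)| := by exact_mod_cast Int.one_le_abs hm
    have bn := hC₁ (|(n : ℝ)| + 1) |(n : ℝ)| (by positivity) (by linarith)
    have bm := hC₁ (|(m : ℝ)| + 1) |(m : ℝ)| (by positivity) (by linarith)
    have b2 := hC₂ (|((m + ⌊(n : ℝ) * τ⌋ : ℤ) : ℝ)| + 1) |n * τ + m| (by positivity) (by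
      have := mul_abs_floor_add_one_le hδ hδ1 hX
      rwa [Int.floor_add_intCast, add_comm ⌊_⌋] at this)
    have b3 := hC₃ (|((n + ⌊(m : ℝ) / τ⌋ : ℤ) : ℝ)| + 1) |n * τ + m| (by positivity) (by
      have hX' : |n * τ + m| = |τ| * |m / τ + n| := by
        rw [← abs_mul]; congr 1; field_simp; ring
      have := mul_abs_floor_add_one_le (y := m / τ + n) hη0 (min_le_left _ _)
        ((min_le_right _ _).trans (by rw [div_le_iff₀' hτ', ← hX']; exact hX))
      rw [Int.floor_add_intCast, add_comm ⌊_⌋] at this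
      rw [hX', mul_assoc]
      gcongr)
    refine (inv_mul_three_le_add (by positivity) (by positivity) (by linarith)).trans ?_
    refine add_le_add (add_le_add ?_ ?_) ?_
    · exact (mul_le_mul bm bn (by positivity) (by positivity)).trans_eq (by ring)
    · exact (mul_le_mul bm b3 (by positivity) (by positivity)).trans_eq (by ring)
    · exact (mul_le_mul bn b2 (by positivity) (by positivity)).trans_eq (by ring)
  · positivity

theorem eq_neg_round_of_abs_lt {x : ℝ} {m : ℤ} (h : |x + m| < 1 / 2) : m = -round x := by
  have h1 := abs_sub_round x
  have h2 : |((m + round x : ℤ) : ℝ)| < 1 := by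
    push_cast
    rw [show (m : ℝ) + round x = (x + m) - (x - round x) by ring]
    exact (abs_sub _ _).trans_lt (by linarith)
  have h3 : |m + round x| < 1 := by exact_mod_cast h2
  have := Int.abs_lt_one_iff.1 h3
  omega

theorem summable_prod_of_abs_lt_half {u : ℤ → ℝ} (hu : Summable u) (τ : ℝ) :
    Summable fun v : ℤ × ℤ => if |v.1 * τ + v.2| < 1 / 2 then |u v.1| else 0 := by
  have hinj : Function.Injective fun n : ℤ => (n, -round (n * τ)) := fun a b h => by
    simpa using congrArg Prod.fst h
  rw [← hinj.summable_iff]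
  · refine Summable.of_nonneg_of_le (fun n => ?_) (fun n => ?_) hu.abs
    · simp only [Function.comp_apply]; positivity
    · simp only [Function.comp_apply]
      split_ifs
      · exact le_rfl
      · positivity
  · rintro ⟨n, m⟩ hnm
    rw [if_neg]
    intro h
    exact hnm ⟨n, Prod.ext rfl (eq_neg_round_of_abs_lt h).symm⟩

/-- Where `|nτ + m| ≥ 1/2` all exponents can be lowered to 1. Where it is smaller, `m` is determined
by `n` and comparable to it, leaving the single series with inverse sines. -/
theorem summable_inv_pow_mul_three {τ : ℝ} (hτ : BadlyApproximable τ) {a b c : ℕ} (ha : 1 ≤ a)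
    (hb : 1 ≤ b) (hc : 1 ≤ c) (habc : c + 1 ≤ a + b) :
    Summable fun v : ℤ × ℤ =>
      (|(v.2 : ℝ)| ^ a * |(v.1 : ℝ)| ^ b * |v.1 * τ + v.2| ^ c)⁻¹ := by
  have hτ0 : 0 < |τ| := abs_pos.2 hτ.ne_zero
  have s1 := (summable_inv_mul_three_of_le hτ.ne_zero (δ := 1 / 2) (by norm_num)
    (by norm_num)).mul_left (2 ^ (c - 1))
  have s2 := (summable_prod_of_abs_lt_half (summable_inv_pow_mul_inv_sin_pow hτ hc habc) τ).mul_left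
    (((2 / 3 * |τ|)⁻¹) ^ a * Real.pi ^ c)
  refine Summable.of_nonneg_of_le (fun v => by positivity) (fun v => ?_) (s1.add s2)
  obtain ⟨n, m⟩ := v
  simp only
  by_cases hn : n = 0
  · simp only [hn, Int.cast_zero, abs_zero, zero_pow (show b ≠ 0 by omega)]
    simp only [mul_zero, zero_mul, inv_zero]
    positivity
  by_cases hm : m = 0
  · simp only [hm, Int.cast_zero, abs_zero, zero_pow (show a ≠ 0 by omega)]
    simp only [zero_mul, inv_zero]
    positivity
  have hn1 : (1 : ℝ) ≤ |(n : ℝ)| := by exact_mod_cast Int.one_le_abs hn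
  have hm1 : (1 : ℝ) ≤ |(m : ℝ)| := by exact_mod_cast Int.one_le_abs hm
  set X := (n : ℝ) * τ + m with hX
  have hX0 : 0 < |X| := abs_pos.2 (hτ.mul_add_ne_zero hn m)
  by_cases h : 1 / 2 ≤ |X|
  · rw [if_pos ⟨hn, hm, h⟩, if_neg (not_lt.2 h), mul_zero, add_zero]
    obtain ⟨c, rfl⟩ := Nat.exists_eq_add_of_le' hc
    have h2 : (|X| ^ (c + 1))⁻¹ ≤ 2 ^ c * |X|⁻¹ := by
      rw [← inv_pow, pow_succ]
      gcongr
      rw [inv_le_comm₀ hX0 (by norm_num)]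
      linarith
    rw [mul_inv, mul_inv, mul_inv, mul_inv, Nat.add_sub_cancel]
    calc _ ≤ |(m : ℝ)|⁻¹ * |(n : ℝ)|⁻¹ * (2 ^ c * |X|⁻¹) := by
          gcongr
          · exact le_self_pow₀ hm1 (by omega)
          · exact le_self_pow₀ hn1 (by omega)
      _ = _ := by ring
  · rw [if_neg (fun h' => h h'.2.2), if_pos (not_le.1 h), mul_zero, zero_add,
      abs_of_nonneg (a := (|(n : ℝ)| ^ (a + b))⁻¹ * _) (by positivity), pow_add]
    -- From `|nτ| ≤ 1/2 + |m| ≤ (3/2) |m|`, as `|m| ≥ 1`.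
    have h1 : 2 / 3 * |τ| * |(n : ℝ)| ≤ |(m : ℝ)| := by
      have : |(n : ℝ) * τ| ≤ |X| + |(m : ℝ)| := by
        rw [show (n : ℝ) * τ = X - m by rw [hX]; ring]
        exact abs_sub _ _
      rw [abs_mul] at this
      linarith
    have h2 : |Real.sin (Real.pi * (n * τ))| ≤ Real.pi * |X| :=
      abs_sin_le_pi_mul_abs_add_int _ _
    have hs : 0 < |Real.sin (Real.pi * (n * τ))| :=
      abs_pos.2 (sin_pi_mul_ne_zero (hτ.mul_add_ne_zero hn))
    calc _ ≤ ((2 / 3 * |τ| * |(n : ℝ)|) ^ a * |(n : ℝ)| ^ b *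
          (Real.pi⁻¹ * |Real.sin (Real.pi * (n * τ))|) ^ c)⁻¹ := by
          gcongr
          rw [inv_mul_le_iff₀ Real.pi_pos]
          exact h2
      _ = _ := by
          simp only [mul_pow, mul_inv, inv_pow, inv_inv]
          ring

theorem inv_pow_sub_inv_pow {X Y : ℝ} (hX : X ≠ 0) (hY : Y ≠ 0) (q : ℕ) :
    (X ^ q)⁻¹ - (Y ^ q)⁻¹ =
      (Y - X) * ∑ i ∈ Finset.range q, (X ^ (i + 1))⁻¹ * (Y ^ (q - i))⁻¹ := by
  have h := (Commute.all X⁻¹ Y⁻¹).geom_sum₂_mul q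
  rw [inv_pow, inv_pow] at h
  rw [← h, inv_sub_inv hX hY, mul_comm, div_mul_eq_mul_div, mul_div_assoc, Finset.sum_div]
  congr 1
  refine Finset.sum_congr rfl fun i hi => ?_
  have : q - i = q - 1 - i + 1 := by have := Finset.mem_range.1 hi; omega
  rw [this, pow_succ, pow_succ]
  simp only [inv_pow]
  field_simp

/-- Absolute convergence of the double series that underlies the inversion formula. -/
theorem summable_inversion {τ : ℝ} (hτ : BadlyApproximable τ) (g : ZMod 4 → ZMod 4 → ℚ)
    {p q : ℕ} (hq : 1 ≤ q) (hpq : q + 1 ≤ p) :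
    Summable fun v : ℤ × ℤ => (g v.1 v.2 : ℝ) *
      (((v.2 : ℝ) ^ p)⁻¹ * (((v.1 * τ + v.2) ^ q)⁻¹ - ((v.1 * τ) ^ q)⁻¹)) := by
  have hτ0 := hτ.ne_zero
  have s1 : Summable fun v : ℤ × ℤ => ∑ i ∈ Finset.range q, (|τ| ^ (q - i))⁻¹ *
      (|(v.2 : ℝ)| ^ (p - 1) * |(v.1 : ℝ)| ^ (q - i) * |v.1 * τ + v.2| ^ (i + 1))⁻¹ := by
    refine summable_sum fun i hi => Summable.mul_left _ ?_
    have := Finset.mem_range.1 hi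
    exact summable_inv_pow_mul_three hτ (by omega) (by omega) (by omega) (by omega)
  -- On the line `n = 0` the subtracted term is `0` by default, so `m^(-(p+q))` remains.
  have s2 : Summable fun v : ℤ × ℤ => if v.1 = 0 then (|(v.2 : ℝ)| ^ (p + q))⁻¹ else 0 := by
    have hinj : Function.Injective fun m : ℤ => ((0 : ℤ), m) := fun a b h => by simpa using h
    rw [← hinj.summable_iff]
    · have := (summable_inv_int_pow (q := p + q) (by omega)).abs
      refine this.congr fun m => ?_
      simp [abs_inv, abs_pow]
    · rintro ⟨n, m⟩ hnm
      rw [if_neg]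
      rintro rfl
      exact hnm ⟨m, rfl⟩
  refine ((s1.add s2).mul_left (∑ a, ∑ k, |(g a k : ℝ)|)).of_norm_bounded ?_
  rintro ⟨n, m⟩
  rw [norm_mul, Real.norm_eq_abs]
  simp only
  have h2 : |(g n m : ℝ)| ≤ ∑ a, ∑ k, |(g a k : ℝ)| :=
    (Finset.single_le_sum (f := fun k => |(g n k : ℝ)|) (fun k _ => abs_nonneg _)
      (Finset.mem_univ _)).trans (Finset.single_le_sum (f := fun a => ∑ k, |(g a k : ℝ)|)
        (fun a _ => Finset.sum_nonneg fun k _ => abs_nonneg _) (Finset.mem_univ _))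
  refine mul_le_mul h2 ?_ (norm_nonneg _) (Finset.sum_nonneg fun a _ => Finset.sum_nonneg
    fun k _ => abs_nonneg _)
  rcases eq_or_ne n 0 with rfl | hn
  · rw [if_pos rfl]
    refine le_trans ?_ (le_add_of_nonneg_left (Finset.sum_nonneg fun i _ => by positivity))
    simp [show q ≠ 0 by omega, pow_add, mul_comm]
  · rw [if_neg hn, add_zero]
    have hnR : (n : ℝ) ≠ 0 := by exact_mod_cast hn
    have hX := hτ.mul_add_ne_zero hn m
    obtain ⟨p, rfl⟩ : ∃ p', p = p' + 1 := ⟨p - 1, by omega⟩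
    -- The regularizing difference produces a factor `-m`, which lowers the exponent of `m` to `p -
    -- 1` and leaves products of three inverse powers.
    rw [inv_pow_sub_inv_pow hX (mul_ne_zero hnR hτ0), show (n : ℝ) * τ - (n * τ + m) = -m by ring,
      Finset.mul_sum, Finset.mul_sum]
    refine (norm_sum_le _ _).trans (Finset.sum_le_sum fun i _ => ?_)
    rcases eq_or_ne m 0 with rfl | hm
    · simp only [Int.cast_zero, neg_zero, zero_mul, mul_zero, norm_zero]
      positivity
    · have hmR : |(m : ℝ)| ≠ 0 := abs_ne_zero.2 (by exact_mod_cast hm)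
      apply le_of_eq
      simp only [norm_mul, norm_neg, norm_inv, norm_pow, Real.norm_eq_abs, mul_inv,
        mul_pow, Nat.add_sub_cancel, pow_succ |(m : ℝ)| p]
      field_simp

/-! ### Partial fractions. -/

theorem inv_add_mul_inv {A B : ℝ} (hA : A ≠ 0) (hB : B ≠ 0) (hC : A + B ≠ 0) :
    (A + B)⁻¹ * B⁻¹ = A⁻¹ * (B⁻¹ - (A + B)⁻¹) := by
  field_simp
  ring

/-- Partial fractions of `C^(-p) B^(-q)` with respect to `C = A + B`. -/
theorem exists_partialFractions (p q : ℕ) : ∃ c d : ℕ → ℚ, c 0 = 1 ∧ d p = (-1) ^ (q + 1) ∧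
    d 0 + c q = 0 ∧ ∀ A B : ℝ, A ≠ 0 → B ≠ 0 → A + B ≠ 0 →
    ((A + B) ^ (p + 1))⁻¹ * (B ^ (q + 1))⁻¹ =
      ∑ i ∈ Finset.range (q + 1), (c i : ℝ) * ((A ^ (p + 1 + i))⁻¹ * (B ^ (q + 1 - i))⁻¹) +
      ∑ r ∈ Finset.range (p + 1), (d r : ℝ) * ((A ^ (p + q + 1 - r))⁻¹ * ((A + B) ^ (r + 1))⁻¹) := by
  induction p generalizing q with
  | zero =>
    refine ⟨fun i => (-1) ^ i, fun _ => (-1) ^ (q + 1), by simp, rfl, by simp [pow_succ], ?_⟩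
    intro A B hA hB hC
    have h := inv_add_mul_inv hA hB hC
    induction q with
    | zero => simp [h]; ring
    | succ q ih =>
      rw [Finset.sum_range_succ]
      have e : ∀ i ∈ Finset.range (q + 1), ((((-1 : ℚ) ^ i : ℚ) : ℝ)) *
          ((A ^ (0 + 1 + i))⁻¹ * (B ^ (q + 1 + 1 - i))⁻¹) = B⁻¹ * ((((-1 : ℚ) ^ i : ℚ) : ℝ) *
          ((A ^ (0 + 1 + i))⁻¹ * (B ^ (q + 1 - i))⁻¹)) := by
        intro i hi
        have := Finset.mem_range.1 hi
        rw [show q + 1 + 1 - i = q + 1 - i + 1 by omega, pow_succ (B), mul_inv]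
        ring
      rw [Finset.sum_congr rfl e, ← Finset.mul_sum, pow_succ B (q + 1), mul_inv, ← mul_assoc, ih]
      simp only [zero_add, Finset.sum_range_one, Nat.sub_zero, pow_one]
      push_cast
      rw [show q + 1 - q = 1 by omega, add_comm 1 (q + 1), pow_succ A (q + 1)]
      simp only [mul_inv, pow_one]
      linear_combination ((-1 : ℝ) ^ (q + 1) * (A ^ (q + 1))⁻¹) * h
  | succ p ihp =>
    induction q with
    | zero =>
      refine ⟨fun _ => 1, fun _ => -1, rfl, by simp, by simp, ?_⟩
      intro A B hA hB hC
      have h := inv_add_mul_inv hA hB hC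
      clear ihp
      generalize p + 1 = k
      induction k with
      | zero => simp [h]; ring
      | succ k ih =>
        rw [Finset.sum_range_succ' _ (k + 1)]
        have e : ∀ r ∈ Finset.range (k + 1), ((-1 : ℚ) : ℝ) * ((A ^ (k + 1 + 1 - (r + 1)))⁻¹ *
            ((A + B) ^ (r + 1 + 1))⁻¹) = (A + B)⁻¹ * (((-1 : ℚ) : ℝ) * ((A ^ (k + 1 - r))⁻¹ *
            ((A + B) ^ (r + 1))⁻¹)) := by
          intro r hr
          rw [show k + 1 + 1 - (r + 1) = k + 1 - r by omega, pow_succ (A + B) (r + 1), mul_inv]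
          ring
        have e' := (Finset.sum_congr rfl e).trans (Finset.mul_sum ..).symm
        rw [e', pow_succ (A + B) (k + 1), mul_inv,
          mul_comm ((A + B) ^ (k + 1))⁻¹, mul_assoc, ih]
        simp only [zero_add, add_zero, Finset.sum_range_one, Nat.sub_zero, pow_one]
        push_cast
        rw [pow_succ A (k + 1)]
        simp only [mul_inv]
        linear_combination (A ^ (k + 1))⁻¹ * h
    | succ q ihq =>
      obtain ⟨c₁, d₁, hc₁, hd₁, hcd₁, h₁⟩ := ihp (q + 1)
      obtain ⟨c₂, d₂, hc₂, hd₂, hcd₂, h₂⟩ := ihq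
      refine ⟨fun i => c₁ i - if i = 0 then 0 else c₂ (i - 1),
        fun r => (if r ≤ p then d₁ r else 0) - d₂ r, by simp [hc₁], by simp [hd₂, pow_succ], ?_, ?_⟩
      · simp
        linarith
      intro A B hA hB hC
      have h := inv_add_mul_inv hA hB hC
      have h₁' := h₁ A B hA hB hC
      have h₂' := h₂ A B hA hB hC
      -- The basic identity lowers one of the two exponents in each term, so both induction
      -- hypotheses apply.
      have key : ((A + B) ^ (p + 1 + 1))⁻¹ * (B ^ (q + 1 + 1))⁻¹ =
          A⁻¹ * (((A + B) ^ (p + 1))⁻¹ * (B ^ (q + 1 + 1))⁻¹) -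
          A⁻¹ * (((A + B) ^ (p + 1 + 1))⁻¹ * (B ^ (q + 1))⁻¹) := by
        rw [pow_succ (A + B) (p + 1), pow_succ B (q + 1)]
        simp only [mul_inv]
        linear_combination (((A + B) ^ (p + 1))⁻¹ * (B ^ (q + 1))⁻¹) * h
      rw [key, h₁', h₂']
      push_cast
      simp only [sub_mul, Finset.sum_sub_distrib, mul_add, Finset.mul_sum]
      rw [Finset.sum_range_succ' (fun i => (((if i = 0 then 0 else c₂ (i - 1) : ℚ) : ℝ)) * _),
        Finset.sum_range_succ (fun r => (((if r ≤ p then d₁ r else 0 : ℚ) : ℝ)) * _) (p + 1)]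
      have e1 : ∀ i ∈ Finset.range (q + 1 + 1), A⁻¹ * ((c₁ i : ℝ) * ((A ^ (p + 1 + i))⁻¹ *
          (B ^ (q + 1 + 1 - i))⁻¹)) = (c₁ i : ℝ) * ((A ^ (p + 1 + 1 + i))⁻¹ *
          (B ^ (q + 1 + 1 - i))⁻¹) := by
        intro i _
        rw [show p + 1 + 1 + i = p + 1 + i + 1 by omega, pow_succ A (p + 1 + i), mul_inv]
        ring
      have e2 : ∀ i ∈ Finset.range (q + 1), A⁻¹ * ((c₂ i : ℝ) * ((A ^ (p + 1 + 1 + i))⁻¹ *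
          (B ^ (q + 1 - i))⁻¹)) = (((if i + 1 = 0 then 0 else c₂ (i + 1 - 1) : ℚ) : ℝ)) *
          ((A ^ (p + 1 + 1 + (i + 1)))⁻¹ * (B ^ (q + 1 + 1 - (i + 1)))⁻¹) := by
        intro i _
        rw [show p + 1 + 1 + (i + 1) = p + 1 + 1 + i + 1 by omega, pow_succ A (p + 1 + 1 + i),
          mul_inv, show q + 1 + 1 - (i + 1) = q + 1 - i by omega, if_neg (Nat.succ_ne_zero i),
          Nat.add_sub_cancel]
        ring
      have e3 : ∀ r ∈ Finset.range (p + 1), A⁻¹ * ((d₁ r : ℝ) * ((A ^ (p + (q + 1) + 1 - r))⁻¹ *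
          ((A + B) ^ (r + 1))⁻¹)) = (((if r ≤ p then d₁ r else 0 : ℚ) : ℝ)) *
          ((A ^ (p + 1 + (q + 1) + 1 - r))⁻¹ * ((A + B) ^ (r + 1))⁻¹) := by
        intro r hr
        have hr' := Finset.mem_range.1 hr
        rw [show p + 1 + (q + 1) + 1 - r = p + (q + 1) + 1 - r + 1 by omega,
          pow_succ A (p + (q + 1) + 1 - r), mul_inv, if_pos (by omega)]
        ring
      have e4 : ∀ r ∈ Finset.range (p + 1 + 1), A⁻¹ * ((d₂ r : ℝ) * ((A ^ (p + 1 + q + 1 - r))⁻¹ *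
          ((A + B) ^ (r + 1))⁻¹)) = (d₂ r : ℝ) *
          ((A ^ (p + 1 + (q + 1) + 1 - r))⁻¹ * ((A + B) ^ (r + 1))⁻¹) := by
        intro r hr
        have hr' := Finset.mem_range.1 hr
        rw [show p + 1 + (q + 1) + 1 - r = p + 1 + q + 1 - r + 1 by omega,
          pow_succ A (p + 1 + q + 1 - r), mul_inv]
        ring
      rw [Finset.sum_congr rfl e1, Finset.sum_congr rfl e2, Finset.sum_congr rfl e3,
        Finset.sum_congr rfl e4]
      simp
      ring

/-- The partial fractions arranged so that every sum over `C` of a term converges absolutely. -/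
theorem exists_partialFractions_sub {p q : ℕ} (hq : 1 ≤ q) (hpq : q + 1 ≤ p) :
    ∃ c e : ℕ → ℚ, c 0 = 1 ∧ ∀ A B : ℝ, A ≠ 0 → B ≠ 0 → A + B ≠ 0 →
    ((A + B) ^ p)⁻¹ * ((B ^ q)⁻¹ - ((-A) ^ q)⁻¹) =
      ∑ i ∈ Finset.range q, (c i : ℝ) *
        ((A ^ (p + i))⁻¹ * ((B ^ (q - i))⁻¹ - ((A + B) ^ (q - i))⁻¹)) +
      ∑ r ∈ Finset.Ico 2 p, (e r : ℝ) * ((A ^ (p + q - r))⁻¹ * ((A + B) ^ r)⁻¹) := by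
  obtain ⟨q, rfl⟩ := Nat.exists_eq_add_of_le' hq
  obtain ⟨p, rfl⟩ : ∃ p', p = p' + 1 + 1 := ⟨p - 2, by omega⟩
  obtain ⟨c, d, hc, hd, hcd, h⟩ := exists_partialFractions (p + 1) q
  -- The part `c (q + 1 - r)` repays the powers of `A + B` subtracted in the first sum; `d (r - 1)`
  -- is the original coefficient. The simple poles `r = 1` cancel by `d 0 + c q = 0`, and the top
  -- term `r = p` cancels against `(-A)^(-q)`.
  refine ⟨c, fun r => (if r < q + 2 then c (q + 1 - r) else 0) + d (r - 1), hc, ?_⟩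
  intro A B hA hB hC
  have h1 := h A B hA hB hC
  rw [mul_sub, h1, Finset.sum_range_succ (fun r => (d r : ℝ) * _) (p + 1),
    Finset.sum_range_succ' (fun r => (d r : ℝ) * _) p, hd]
  have hcd' : (d 0 : ℝ) = -(c q : ℝ) := by
    have : (d 0 : ℝ) + c q = 0 := by exact_mod_cast hcd
    linarith
  simp only [mul_sub, Finset.sum_sub_distrib]
  have s1 : ∑ i ∈ Finset.range (q + 1), (c i : ℝ) * ((A ^ (p + 1 + 1 + i))⁻¹ *
      ((A + B) ^ (q + 1 - i))⁻¹) = ∑ r ∈ Finset.Ico 2 (q + 2), (c (q + 1 - r) : ℝ) *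
      ((A ^ (p + 1 + 1 + (q + 1) - r))⁻¹ * ((A + B) ^ r)⁻¹) +
      (c q : ℝ) * ((A ^ (p + 1 + 1 + q))⁻¹ * (A + B)⁻¹) := by
    rw [Finset.sum_range_succ]
    congr 1
    · refine Finset.sum_nbij' (fun i => q + 1 - i) (fun r => q + 1 - r) ?_ ?_ ?_ ?_ ?_ <;>
        simp only [Finset.mem_range, Finset.mem_Ico]
      · intro i hi; omega
      · intro i hi; omega
      · intro i hi; omega
      · intro i hi; omega
      · intro i hi
        rw [show q + 1 - (q + 1 - i) = i by omega,
          show p + 1 + 1 + (q + 1) - (q + 1 - i) = p + 1 + 1 + i by omega]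
    · rw [show q + 1 - q = 1 by omega, pow_one]
  have s2 : ∑ r ∈ Finset.Ico 2 (p + 1 + 1),
      ((((if r < q + 2 then c (q + 1 - r) else 0) + d (r - 1) : ℚ)) : ℝ) *
      ((A ^ (p + 1 + 1 + (q + 1) - r))⁻¹ * ((A + B) ^ r)⁻¹) =
      ∑ r ∈ Finset.Ico 2 (q + 2), (c (q + 1 - r) : ℝ) *
      ((A ^ (p + 1 + 1 + (q + 1) - r))⁻¹ * ((A + B) ^ r)⁻¹) +
      ∑ r ∈ Finset.range p, (d (r + 1) : ℝ) * ((A ^ (p + 1 + q + 1 - (r + 1)))⁻¹ *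
        ((A + B) ^ (r + 1 + 1))⁻¹) := by
    push_cast
    simp only [add_mul, Finset.sum_add_distrib]
    congr 1
    · rw [← Finset.sum_subset (s₁ := Finset.Ico 2 (q + 2))]
      · refine Finset.sum_congr rfl fun r hr => ?_
        rw [if_pos (Finset.mem_Ico.1 hr).2]
      · exact Finset.Ico_subset_Ico_right (by omega)
      · intro r hr hr'
        simp only [Finset.mem_Ico] at hr hr'
        rw [if_neg (by omega)]
        simp
    · rw [Finset.sum_Ico_eq_sum_range]
      refine Finset.sum_congr (by simp) fun r hr => ?_
      rw [show 2 + r - 1 = r + 1 by omega, show 2 + r = r + 1 + 1 by omega,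
        show p + 1 + 1 + (q + 1) - (r + 1 + 1) = p + 1 + q - r by omega]
  have hneg : ((-A) ^ (q + 1))⁻¹ = (-1) ^ (q + 1) * (A ^ (q + 1))⁻¹ := by
    rw [neg_pow, mul_inv, ← inv_pow (-1 : ℝ), inv_neg, inv_one]
  rw [s1, s2, hcd', show p + 1 + q + 1 - (p + 1) = q + 1 by omega, hneg]
  have e : p + 1 + q + 1 - 0 = p + 1 + 1 + q := by omega
  rw [e]
  push_cast
  norm_num
  ring

/-! ### Double Eisenstein sums and the inversion formula. -/

/-- The rational number `π^(-q) ∑_{m ≠ 0} h(m) m^(-q)`, suitably regularized for `q = 1`. -/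
noncomputable def wConst (h : ZMod 4 → ℚ) (q : ℕ) : ℚ :=
  if hq : 1 ≤ q then (exists_rat_hasSum_wEisen h hq).choose else 0

theorem hasSum_wEisen (h : ZMod 4 → ℚ) {q : ℕ} (hq : 1 ≤ q) {x : ℝ} (hx : ∀ m : ℤ, x + m ≠ 0) :
    HasSum (fun m : ℤ => (h m : ℝ) * (((x + m) ^ q)⁻¹ - ((m : ℝ) ^ q)⁻¹))
      (wEisen h q x - Real.pi ^ q * wConst h q) := by
  rw [wConst, dif_pos hq]
  exact (exists_rat_hasSum_wEisen h hq).choose_spec.1 x hx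

theorem hasSum_wConst (h : ZMod 4 → ℚ) {q : ℕ} (hq : 2 ≤ q) :
    HasSum (fun m : ℤ => (h m : ℝ) * ((m : ℝ) ^ q)⁻¹) (Real.pi ^ q * wConst h q) := by
  have hq' : 1 ≤ q := by omega
  rw [wConst, dif_pos hq']
  exact (exists_rat_hasSum_wEisen h hq').choose_spec.2 hq

theorem hasSum_wConst_wConst (g : ZMod 4 → ZMod 4 → ℚ) {b : ℕ} (hb : 2 ≤ b) (r : ℕ) :
    HasSum (fun n : ℤ => ((n : ℝ) ^ b)⁻¹ * (Real.pi ^ r * wConst (g n) r))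
      (Real.pi ^ (b + r) * wConst (fun n => wConst (g n) r) b) := by
  convert! (hasSum_wConst (fun n => wConst (g n) r) hb).mul_left (Real.pi ^ r) using 1
  · ext n
    ring
  · ring

/-- The double Eisenstein sum `∑_{n ≠ 0} ∑ₘ f(n, m) n^(-p) (n τ + m)^(-q)`. -/
noncomputable def doubleSum (p q : ℕ) (f : ZMod 4 → ZMod 4 → ℚ) (τ : ℝ) : ℝ :=
  ∑' n : ℤ, ((n : ℝ) ^ p)⁻¹ * wEisen (f n) q (n * τ)

theorem hasSum_doubleSum {τ : ℝ} (hτ : BadlyApproximable τ) (f : ZMod 4 → ZMod 4 → ℚ)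
    {p q : ℕ} (hq : 1 ≤ q) (hpq : q + 1 ≤ p) :
    HasSum (fun n : ℤ => ((n : ℝ) ^ p)⁻¹ * wEisen (f n) q (n * τ)) (doubleSum p q f τ) :=
  (summable_inv_pow_mul_wEisen hτ f hq hpq).hasSum

/-- Since `nτ + m = τ (m/τ + n)`, summing over `n` first gives an Eisenstein series at `m/τ`. -/
theorem hasSum_inversion_row {τ : ℝ} (hτ0 : τ ≠ 0) (hτ' : BadlyApproximable τ⁻¹) {p q : ℕ} (hq : 1 ≤ q)
    (hp : 1 ≤ p) (g : ZMod 4 → ZMod 4 → ℚ) (m : ℤ) :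
    HasSum (fun n : ℤ => (g n m : ℝ) * (((m : ℝ) ^ p)⁻¹ * (((n * τ + m) ^ q)⁻¹ - ((n * τ) ^ q)⁻¹)))
      ((τ ^ q)⁻¹ * (((m : ℝ) ^ p)⁻¹ * wEisen (fun n => g n m) q (m * τ⁻¹) -
        ((m : ℝ) ^ p)⁻¹ * (Real.pi ^ q * wConst (fun n => g n m) q))) := by
  rcases eq_or_ne m 0 with rfl | hm
  · simp [show p ≠ 0 by omega, hasSum_zero]
  · have h := hasSum_wEisen (fun n => g n m) hq (hτ'.mul_add_ne_zero hm)
    convert! h.mul_left ((τ ^ q)⁻¹ * ((m : ℝ) ^ p)⁻¹) using 1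
    · ext n
      rw [show (n : ℝ) * τ + m = τ * (m * τ⁻¹ + n) by field_simp; ring, mul_pow, mul_inv,
        mul_pow, mul_inv]
      ring
    · ring

/-- Summing over `m` first, with partial fractions at `A = -nτ`, `B = nτ + m`, `A + B = m`. Each
piece is then an Eisenstein series at `nτ` or a zeta constant; `n = 0`, where `A = 0`, is separate.
-/
theorem hasSum_inversion_col {τ : ℝ} (hτ : BadlyApproximable τ) {p q : ℕ} (hq : 1 ≤ q)
    (hpq : q + 1 ≤ p) (g : ZMod 4 → ZMod 4 → ℚ) {c e : ℕ → ℚ} (hPF : ∀ A B : ℝ, A ≠ 0 → B ≠ 0 → A + B ≠ 0 →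
    ((A + B) ^ p)⁻¹ * ((B ^ q)⁻¹ - ((-A) ^ q)⁻¹) =
      ∑ i ∈ Finset.range q, (c i : ℝ) *
        ((A ^ (p + i))⁻¹ * ((B ^ (q - i))⁻¹ - ((A + B) ^ (q - i))⁻¹)) +
      ∑ r ∈ Finset.Ico 2 p, (e r : ℝ) * ((A ^ (p + q - r))⁻¹ * ((A + B) ^ r)⁻¹))
    (n : ℤ) :
    HasSum (fun m : ℤ => (g n m : ℝ) * (((m : ℝ) ^ p)⁻¹ * (((n * τ + m) ^ q)⁻¹ - ((n * τ) ^ q)⁻¹)))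
      ((∑ i ∈ Finset.range q, (c i : ℝ) * (((-τ) ^ (p + i))⁻¹ *
          (((n : ℝ) ^ (p + i))⁻¹ * wEisen (g n) (q - i) (n * τ) -
            ((n : ℝ) ^ (p + i))⁻¹ * (Real.pi ^ (q - i) * wConst (g n) (q - i)) -
            (τ ^ (q - i))⁻¹ * ((g n 0 : ℝ) * ((n : ℝ) ^ (p + q))⁻¹))) +
        ∑ r ∈ Finset.Ico 2 p, (e r : ℝ) * (((-τ) ^ (p + q - r))⁻¹ *
          (((n : ℝ) ^ (p + q - r))⁻¹ * (Real.pi ^ r * wConst (g n) r)))) +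
        if n = 0 then Real.pi ^ (p + q) * wConst (g 0) (p + q) else 0) := by
  have hτ0 := hτ.ne_zero
  rcases eq_or_ne n 0 with rfl | hn
  · convert! hasSum_wConst (g 0) (q := p + q) (by omega) using 1
    · ext m
      have z : (0 : ℝ) ^ q = 0 := zero_pow (by omega)
      simp only [Int.cast_zero, zero_mul, zero_add, z, inv_zero, sub_zero, pow_add, mul_inv]
    · rw [if_pos rfl, Finset.sum_eq_zero, Finset.sum_eq_zero]
      · simp
      · intro r hr
        have := Finset.mem_Ico.1 hr
        have z : (0 : ℝ) ^ (p + q - r) = 0 := zero_pow (by omega)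
        simp only [Int.cast_zero, z, inv_zero, zero_mul, mul_zero]
      · intro i hi
        have z1 : (0 : ℝ) ^ (p + i) = 0 := zero_pow (by omega)
        have z2 : (0 : ℝ) ^ (p + q) = 0 := zero_pow (by omega)
        simp only [Int.cast_zero, z1, z2, inv_zero, zero_mul, mul_zero, sub_zero]
  · have hnR : (n : ℝ) ≠ 0 := by exact_mod_cast hn
    rw [if_neg hn, add_zero]
    have h1 : HasSum (fun m : ℤ => ∑ i ∈ Finset.range q, (c i : ℝ) * ((((-(n * τ)) ^ (p + i))⁻¹) *
        ((g n m : ℝ) * (((n * τ + m) ^ (q - i))⁻¹ - ((m : ℝ) ^ (q - i))⁻¹))))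
        (∑ i ∈ Finset.range q, (c i : ℝ) * ((((-(n * τ)) ^ (p + i))⁻¹) *
          (wEisen (g n) (q - i) (n * τ) - Real.pi ^ (q - i) * wConst (g n) (q - i)))) := by
      refine hasSum_sum fun i hi => ?_
      have := Finset.mem_range.1 hi
      exact ((hasSum_wEisen (g n) (by omega) (hτ.mul_add_ne_zero hn)).mul_left _).mul_left _
    have h2 : HasSum (fun m : ℤ => ∑ r ∈ Finset.Ico 2 p, (e r : ℝ) *
        ((((-(n * τ)) ^ (p + q - r))⁻¹) * ((g n m : ℝ) * ((m : ℝ) ^ r)⁻¹)))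
        (∑ r ∈ Finset.Ico 2 p, (e r : ℝ) * ((((-(n * τ)) ^ (p + q - r))⁻¹) *
          (Real.pi ^ r * wConst (g n) r))) := by
      refine hasSum_sum fun r hr => ?_
      exact ((hasSum_wConst (g n) (Finset.mem_Ico.1 hr).1).mul_left _).mul_left _
    -- The original term vanishes at `m = 0` by the convention `0⁻¹ = 0`, but its partial fractions
    -- leave `(nτ)^(-(q-i))` there; this is removed.
    have h3 := hasSum_ite_eq (0 : ℤ) (∑ i ∈ Finset.range q, (c i : ℝ) *
      ((((-(n * τ)) ^ (p + i))⁻¹) * ((g n 0 : ℝ) * ((n * τ) ^ (q - i))⁻¹)))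
    convert! (h1.add h2).sub h3 using 1
    · ext m
      rcases eq_or_ne m 0 with rfl | hm
      · rw [if_pos rfl, eq_comm, add_sub_right_comm, ← Finset.sum_sub_distrib,
          Finset.sum_eq_zero, Finset.sum_eq_zero]
        · simp [show p ≠ 0 by omega]
        · intro r hr
          have := Finset.mem_Ico.1 hr
          simp [show r ≠ 0 by omega]
        · intro i hi
          have := Finset.mem_range.1 hi
          simp [show q - i ≠ 0 by omega]
      · have hmR : (m : ℝ) ≠ 0 := by exact_mod_cast hm
        have hX := hτ.mul_add_ne_zero hn m
        have hAB : -((n : ℝ) * τ) + (n * τ + m) = m := by ring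
        have := hPF (-(n * τ)) (n * τ + m) (neg_ne_zero.2 (mul_ne_zero hnR hτ0)) hX
          (by rwa [hAB])
        rw [hAB, neg_neg] at this
        rw [if_neg hm, sub_zero, this, mul_add, Finset.mul_sum, Finset.mul_sum]
        congr 1
        · exact Finset.sum_congr rfl fun i _ => by ring
        · exact Finset.sum_congr rfl fun i _ => by ring
    · rw [add_sub_right_comm, ← Finset.sum_sub_distrib]
      have hneg : ∀ k : ℕ, ((-((n : ℝ) * τ)) ^ k)⁻¹ = ((-τ) ^ k)⁻¹ * ((n : ℝ) ^ k)⁻¹ := by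
        intro k
        rw [← mul_inv, ← mul_pow]
        congr 2
        ring
      congr 1
      · refine Finset.sum_congr rfl fun i hi => ?_
        have hi' := Finset.mem_range.1 hi
        rw [hneg, mul_pow, mul_inv, show p + q = p + i + (q - i) by omega,
          pow_add (n : ℝ) (p + i), mul_inv]
        ring
      · refine Finset.sum_congr rfl fun r hr => ?_
        rw [hneg]
        ring

/-- Absolute convergence lets the rows and the columns be summed in either order; the two results
are equated. -/
theorem doubleSum_inv_aux {τ : ℝ} (hτ : BadlyApproximable τ) (hτ' : BadlyApproximable τ⁻¹)
    {p q : ℕ} (hq : 1 ≤ q)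
    (hpq : q + 1 ≤ p) (g : ZMod 4 → ZMod 4 → ℚ) {c e : ℕ → ℚ} (hPF : ∀ A B : ℝ, A ≠ 0 → B ≠ 0 → A + B ≠ 0 →
    ((A + B) ^ p)⁻¹ * ((B ^ q)⁻¹ - ((-A) ^ q)⁻¹) =
      ∑ i ∈ Finset.range q, (c i : ℝ) *
        ((A ^ (p + i))⁻¹ * ((B ^ (q - i))⁻¹ - ((A + B) ^ (q - i))⁻¹)) +
      ∑ r ∈ Finset.Ico 2 p, (e r : ℝ) * ((A ^ (p + q - r))⁻¹ * ((A + B) ^ r)⁻¹)) :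
    (τ ^ q)⁻¹ * (doubleSum p q (fun a b => g b a) τ⁻¹ - Real.pi ^ (p + q) *
      wConst (fun m => wConst (fun n => g n m) q) p) =
    (∑ i ∈ Finset.range q, (c i : ℝ) * (((-τ) ^ (p + i))⁻¹ *
        (doubleSum (p + i) (q - i) g τ -
          Real.pi ^ (p + q) * wConst (fun n => wConst (g n) (q - i)) (p + i) -
          (τ ^ (q - i))⁻¹ * (Real.pi ^ (p + q) * wConst (fun n => g n 0) (p + q)))) +
      ∑ r ∈ Finset.Ico 2 p, (e r : ℝ) * (((-τ) ^ (p + q - r))⁻¹ *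
        (Real.pi ^ (p + q) * wConst (fun n => wConst (g n) r) (p + q - r)))) +
    Real.pi ^ (p + q) * wConst (g 0) (p + q) := by
  have hF := (summable_inversion hτ g hq hpq).hasSum
  have hL := ((Equiv.prodComm ℤ ℤ).hasSum_iff.2 hF).prod_fiberwise
    (hasSum_inversion_row hτ.ne_zero hτ' hq (by omega) g)
  have hR := hF.prod_fiberwise (hasSum_inversion_col hτ hq hpq g hPF)
  have hL' : HasSum (fun m : ℤ => (τ ^ q)⁻¹ * (((m : ℝ) ^ p)⁻¹ *
      wEisen (fun n => g n m) q (m * τ⁻¹) -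
        ((m : ℝ) ^ p)⁻¹ * (Real.pi ^ q * wConst (fun n => g n m) q)))
      ((τ ^ q)⁻¹ * (doubleSum p q (fun a b => g b a) τ⁻¹ - Real.pi ^ (p + q) *
        wConst (fun m => wConst (fun n => g n m) q) p)) :=
    ((hasSum_doubleSum hτ' (fun a b => g b a) hq hpq).sub
      (hasSum_wConst_wConst (fun a b => g b a) (by omega) q)).mul_left _
  rw [← hL.unique hL']
  have hA : ∀ i ∈ Finset.range q, HasSum (fun n : ℤ => (c i : ℝ) * (((-τ) ^ (p + i))⁻¹ *
      (((n : ℝ) ^ (p + i))⁻¹ * wEisen (g n) (q - i) (n * τ) -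
        ((n : ℝ) ^ (p + i))⁻¹ * (Real.pi ^ (q - i) * wConst (g n) (q - i)) -
        (τ ^ (q - i))⁻¹ * ((g n 0 : ℝ) * ((n : ℝ) ^ (p + q))⁻¹))))
      ((c i : ℝ) * (((-τ) ^ (p + i))⁻¹ * (doubleSum (p + i) (q - i) g τ -
          Real.pi ^ (p + q) * wConst (fun n => wConst (g n) (q - i)) (p + i) -
          (τ ^ (q - i))⁻¹ * (Real.pi ^ (p + q) * wConst (fun n => g n 0) (p + q))))) := by
    intro i hi
    have hi' := Finset.mem_range.1 hi
    have h1 := hasSum_doubleSum hτ g (p := p + i) (q := q - i) (by omega) (by omega)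
    have h2 := hasSum_wConst_wConst g (b := p + i) (by omega) (q - i)
    rw [show p + i + (q - i) = p + q by omega] at h2
    have h3 := (hasSum_wConst (fun n => g n 0) (q := p + q) (by omega)).mul_left (τ ^ (q - i))⁻¹
    exact (((h1.sub h2).sub h3).mul_left _).mul_left _
  have hB : ∀ r ∈ Finset.Ico 2 p, HasSum (fun n : ℤ => (e r : ℝ) * (((-τ) ^ (p + q - r))⁻¹ *
      (((n : ℝ) ^ (p + q - r))⁻¹ * (Real.pi ^ r * wConst (g n) r))))
      ((e r : ℝ) * (((-τ) ^ (p + q - r))⁻¹ *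
        (Real.pi ^ (p + q) * wConst (fun n => wConst (g n) r) (p + q - r)))) := by
    intro r hr
    have hr' := Finset.mem_Ico.1 hr
    have h := hasSum_wConst_wConst g (b := p + q - r) (by omega) r
    rw [show p + q - r + r = p + q by omega] at h
    exact (h.mul_left _).mul_left _
  exact hR.unique (((hasSum_sum hA).add (hasSum_sum hB)).add (hasSum_ite_eq (0 : ℤ) _))

/-- Inversion `τ ↦ 1/τ` for double Eisenstein sums. -/
theorem exists_doubleSum_inv {p q : ℕ} (hq : 1 ≤ q) (hpq : q + 1 ≤ p)
    (g : ZMod 4 → ZMod 4 → ℚ) : ∃ (c : ℕ → ℚ) (P : Polynomial ℚ), c 0 = 1 ∧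
    ∀ τ : ℝ, BadlyApproximable τ → BadlyApproximable τ⁻¹ →
      (τ ^ q)⁻¹ * doubleSum p q (fun a b => g b a) τ⁻¹ =
        ∑ i ∈ Finset.range q, (c i : ℝ) * (((-τ) ^ (p + i))⁻¹ * doubleSum (p + i) (q - i) g τ) +
        Real.pi ^ (p + q) * Polynomial.aeval τ⁻¹ P := by
  obtain ⟨c, e, hc, hPF⟩ := exists_partialFractions_sub hq hpq
  refine ⟨c, Polynomial.X ^ q * Polynomial.C (wConst (fun m => wConst (fun n => g n m) q) p) -
    ∑ i ∈ Finset.range q, Polynomial.C (c i) * ((-Polynomial.X) ^ (p + i) *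
      (Polynomial.C (wConst (fun n => wConst (g n) (q - i)) (p + i)) +
        Polynomial.X ^ (q - i) * Polynomial.C (wConst (fun n => g n 0) (p + q)))) +
    ∑ r ∈ Finset.Ico 2 p, Polynomial.C (e r) * ((-Polynomial.X) ^ (p + q - r) *
      Polynomial.C (wConst (fun n => wConst (g n) r) (p + q - r))) +
    Polynomial.C (wConst (g 0) (p + q)), hc, fun τ hτ hτ' => ?_⟩
  have h := doubleSum_inv_aux hτ hτ' hq hpq g hPF
  have hneg : ∀ k : ℕ, ((-τ) ^ k)⁻¹ = (-τ⁻¹) ^ k := fun k => by rw [← inv_pow, inv_neg]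
  rw [mul_sub, sub_eq_iff_eq_add] at h
  rw [h]
  simp only [map_add, map_sub, map_mul, map_sum, map_pow, map_neg, Polynomial.aeval_X,
    Polynomial.aeval_C, eq_ratCast]
  have s1 : ∀ i ∈ Finset.range q, (c i : ℝ) * (((-τ) ^ (p + i))⁻¹ * (doubleSum (p + i) (q - i) g τ -
      Real.pi ^ (p + q) * wConst (fun n => wConst (g n) (q - i)) (p + i) -
      (τ ^ (q - i))⁻¹ * (Real.pi ^ (p + q) * wConst (fun n => g n 0) (p + q)))) =
      (c i : ℝ) * (((-τ) ^ (p + i))⁻¹ * doubleSum (p + i) (q - i) g τ) -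
      Real.pi ^ (p + q) * ((c i : ℝ) * ((-τ⁻¹) ^ (p + i) *
        (wConst (fun n => wConst (g n) (q - i)) (p + i) +
          τ⁻¹ ^ (q - i) * wConst (fun n => g n 0) (p + q)))) := fun i _ => by
    rw [hneg, ← inv_pow]
    ring
  have s2 : ∀ r ∈ Finset.Ico 2 p, (e r : ℝ) * (((-τ) ^ (p + q - r))⁻¹ * (Real.pi ^ (p + q) *
      wConst (fun n => wConst (g n) r) (p + q - r))) = Real.pi ^ (p + q) * ((e r : ℝ) *
      ((-τ⁻¹) ^ (p + q - r) * wConst (fun n => wConst (g n) r) (p + q - r))) := fun r _ => by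
    rw [hneg]
    ring
  rw [Finset.sum_congr rfl s1, Finset.sum_congr rfl s2, Finset.sum_sub_distrib, ← Finset.mul_sum,
    ← Finset.mul_sum, ← inv_pow]
  ring

/-! ### Quadratic elements of a field. -/

open scoped MatrixGroups

/-- An element of a field of characteristic zero that is quadratic over `ℚ`. -/
def IsQuadratic {K : Type*} [Field K] (τ : K) : Prop :=
  (∀ r : ℚ, τ ≠ r) ∧ ∃ A B C : ℤ, A ≠ 0 ∧ (A : K) * τ ^ 2 + B * τ + C = 0

section

variable {K : Type*} [Field K]

theorem isQuadratic_neg {τ : K} (h : IsQuadratic τ) : IsQuadratic (-τ) := by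
  obtain ⟨hr, A, B, C, hA, h⟩ := h
  refine ⟨fun r hr' => hr (-r) (by push_cast; rw [← hr', neg_neg]), A, -B, C, hA, ?_⟩
  push_cast
  linear_combination h

theorem isQuadratic_neg_iff {τ : K} : IsQuadratic (-τ) ↔ IsQuadratic τ :=
  ⟨fun h => neg_neg τ ▸ isQuadratic_neg h, isQuadratic_neg⟩

theorem isQuadratic_add_int [CharZero K] {τ : K} (h : IsQuadratic τ) (k : ℤ) : IsQuadratic (τ + k) := by
  obtain ⟨hr, A, B, C, hA, h⟩ := h
  refine ⟨fun r hr' => hr (r - k) (by push_cast; rw [← hr', add_sub_cancel_right]),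
    A, B - 2 * A * k, A * k ^ 2 - B * k + C, hA, ?_⟩
  push_cast
  linear_combination h

theorem isQuadratic_add_int_iff [CharZero K] {τ : K} {k : ℤ} : IsQuadratic (τ + k) ↔ IsQuadratic τ :=
  ⟨fun h => by simpa using isQuadratic_add_int h (-k), fun h => isQuadratic_add_int h k⟩

theorem IsQuadratic.ne_zero {τ : K} (h : IsQuadratic τ) : τ ≠ 0 := by
  simpa using h.1 0

theorem isQuadratic_inv [CharZero K] {τ : K} (h : IsQuadratic τ) : IsQuadratic τ⁻¹ := by
  have h0 := h.ne_zero
  obtain ⟨hr, A, B, C, hA, h⟩ := h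
  refine ⟨fun r hr' => hr r⁻¹ (by push_cast; rw [← hr', inv_inv]), C, B, A, ?_, ?_⟩
  · rintro rfl
    have hA' : (A : K) ≠ 0 := by exact_mod_cast hA
    have h1 : (A : K) * τ + B = 0 := by
      apply mul_right_cancel₀ h0
      push_cast at h
      linear_combination h
    apply hr (-B / A)
    push_cast
    rw [eq_div_iff hA']
    linear_combination h1
  · field_simp
    linear_combination h

theorem isQuadratic_inv_iff [CharZero K] {τ : K} : IsQuadratic τ⁻¹ ↔ IsQuadratic τ :=
  ⟨fun h => inv_inv τ ▸ isQuadratic_inv h, isQuadratic_inv⟩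

theorem IsQuadratic.map {τ : K} (h : IsQuadratic τ) (σ : K →+* ℝ) : IsQuadratic (σ τ) := by
  obtain ⟨hr, A, B, C, hA, h⟩ := h
  refine ⟨fun r hr' => hr r (σ.injective (by rw [hr', map_ratCast])), A, B, C, hA, ?_⟩
  have := congrArg σ h
  simpa using this

end

-- Liouville's inequality has exponent 2 for a root of a quadratic, which is exactly bad
-- approximability.
open Polynomial in
theorem IsQuadratic.badlyApproximable {x : ℝ} (h : IsQuadratic x) : BadlyApproximable x := by
  obtain ⟨hr, A, B, C, hA, h⟩ := h
  have hirr : Irrational x := by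
    rintro ⟨r, hr'⟩
    exact hr r hr'.symm
  set P : ℤ[X] := Polynomial.C A * X ^ 2 + Polynomial.C B * X + Polynomial.C C with hP
  have hdeg : P.natDegree = 2 := natDegree_quadratic hA
  have hP0 : P ≠ 0 := by
    intro h0
    rw [h0] at hdeg
    simp at hdeg
  obtain ⟨M, hM, hb⟩ := Liouville.exists_pos_real_of_irrational_root hirr hP0 (by
    simp [hP, h])
  rw [hdeg] at hb
  have key : ∀ (b : ℕ) (m : ℤ), M⁻¹ ≤ |((b + 1 : ℕ) : ℝ)| * |((b + 1 : ℕ) : ℝ) * x + m| := by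
    intro b m
    have h1 := hb (-m) b
    have hb0 : (0 : ℝ) < b + 1 := by positivity
    rw [inv_le_iff_one_le_mul₀ hM]
    refine h1.trans_eq ?_
    push_cast
    rw [abs_of_pos hb0, show ((b : ℝ) + 1) * x + m = (b + 1) * (x - -m / (b + 1)) by
      field_simp; ring, abs_mul, abs_of_pos hb0]
    ring
  refine ⟨M⁻¹, inv_pos.2 hM, fun n m hn => ?_⟩
  rcases Int.natAbs_eq n with hn' | hn'
  · have := key (n.natAbs - 1) m
    rw [Nat.sub_add_cancel (Int.natAbs_pos.2 hn)] at this
    rw [hn']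
    simpa using this
  · have := key (n.natAbs - 1) (-m)
    rw [Nat.sub_add_cancel (Int.natAbs_pos.2 hn)] at this
    rw [hn']
    refine this.trans_eq ?_
    simp only [Int.cast_neg, Int.cast_natCast]
    rw [abs_neg, ← abs_neg (_ + (-(m : ℝ))), neg_add, neg_neg, neg_mul]

/-! ### Transformation under `SL(2, ℤ)` modulo `π^w K`, and Pell's equation. -/

theorem doubleSum_neg (p q : ℕ) (f : ZMod 4 → ZMod 4 → ℚ) (x : ℝ) :
    doubleSum p q f (-x) = (-1) ^ p * doubleSum p q (fun a b => f (-a) b) x := by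
  rw [doubleSum, doubleSum, ← (Equiv.neg ℤ).tsum_eq, ← tsum_mul_left]
  refine tsum_congr fun n => ?_
  simp only [Equiv.neg_apply, Int.cast_neg, neg_mul_neg]
  rw [neg_pow, mul_inv, ← inv_pow (-1 : ℝ), inv_neg, inv_one]
  ring

theorem doubleSum_add_one (p q : ℕ) (f : ZMod 4 → ZMod 4 → ℚ) (x : ℝ) :
    doubleSum p q f (x + 1) = doubleSum p q (fun a b => f a (b - a)) x := by
  refine tsum_congr fun n => ?_
  rw [mul_add, mul_one, wEisen_add_int]

section

variable {K : Type*} [Field K]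

/-- A real number attached to each real embedding `σ` of `K` that is `π ^ w * σ k` for a fixed
`k ∈ K`. -/
def IsPiMultiple (w : ℕ) (h : (K →+* ℝ) → ℝ) : Prop :=
  ∃ k : K, ∀ σ, h σ = Real.pi ^ w * σ k

theorem IsPiMultiple.add {w : ℕ} {h₁ h₂ : (K →+* ℝ) → ℝ} (H₁ : IsPiMultiple w h₁)
    (H₂ : IsPiMultiple w h₂) : IsPiMultiple w (fun σ => h₁ σ + h₂ σ) := by
  obtain ⟨k₁, H₁⟩ := H₁
  obtain ⟨k₂, H₂⟩ := H₂
  exact ⟨k₁ + k₂, fun σ => by simp only [H₁, H₂, map_add, mul_add]⟩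

theorem IsPiMultiple.mul_left {w : ℕ} {h : (K →+* ℝ) → ℝ} (c : K) (H : IsPiMultiple w h) :
    IsPiMultiple w (fun σ => σ c * h σ) := by
  obtain ⟨k, H⟩ := H
  exact ⟨c * k, fun σ => by simp only [H, map_mul]; ring⟩

theorem IsPiMultiple.neg {w : ℕ} {h : (K →+* ℝ) → ℝ} (H : IsPiMultiple w h) :
    IsPiMultiple w (fun σ => -h σ) := by
  obtain ⟨k, H⟩ := H
  exact ⟨-k, fun σ => by simp only [H, map_neg, mul_neg]⟩

theorem IsPiMultiple.congr {w : ℕ} {h₁ h₂ : (K →+* ℝ) → ℝ} (H : IsPiMultiple w h₁)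
    (h : ∀ σ, h₂ σ = h₁ σ) : IsPiMultiple w h₂ := by
  rwa [funext h]

theorem IsPiMultiple.sum {w : ℕ} {ι : Type*} (s : Finset ι) {h : ι → (K →+* ℝ) → ℝ}
    (H : ∀ i ∈ s, IsPiMultiple w (h i)) : IsPiMultiple w (fun σ => ∑ i ∈ s, h i σ) := by
  classical
  induction s using Finset.induction_on with
  | empty => exact ⟨0, by simp⟩
  | insert a s ha ih =>
    simp only [Finset.sum_insert ha]
    exact (H a (by simp)).add (ih fun i hi => H i (by simp [hi]))

/-- The action of `SL(2, ℤ)` on pairs. -/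
def slMap (γ : SL(2, ℤ)) (v : K × K) : K × K :=
  ((γ 0 0 : K) * v.1 + (γ 0 1 : K) * v.2, (γ 1 0 : K) * v.1 + (γ 1 1 : K) * v.2)

theorem slMap_mul (γ δ : SL(2, ℤ)) (v : K × K) : slMap (γ * δ) v = slMap γ (slMap δ v) := by
  ext <;> simp [slMap, Matrix.mul_apply, Fin.sum_univ_two] <;> ring

theorem slMap_one (v : K × K) : slMap 1 v = v := by
  ext <;> simp [slMap]

/-- The action of `SL(2, ℤ)` on weights. -/
def slAct (γ : SL(2, ℤ)) (f : ZMod 4 → ZMod 4 → ℚ) : ZMod 4 → ZMod 4 → ℚ :=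
  fun n m => f (n * (γ 1 1 : ℤ) - m * (γ 1 0 : ℤ)) (m * (γ 0 0 : ℤ) - n * (γ 0 1 : ℤ))

theorem slAct_mul (γ δ : SL(2, ℤ)) (f : ZMod 4 → ZMod 4 → ℚ) :
    slAct (γ * δ) f = slAct δ (slAct γ f) := by
  ext n m
  simp only [slAct, Matrix.SpecialLinearGroup.coe_mul, Matrix.mul_apply, Fin.sum_univ_two]
  push_cast
  congr 1 <;> ring

theorem slAct_one (f : ZMod 4 → ZMod 4 → ℚ) : slAct 1 f = f := by
  ext n m
  simp [slAct]

/-- Homogeneous version of the double Eisenstein sum. -/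
noncomputable def homSum (p q : ℕ) (f : ZMod 4 → ZMod 4 → ℚ) (v : K × K) (σ : K →+* ℝ) : ℝ :=
  σ v.2 ^ (p - q) * doubleSum p q f (σ (v.1 / v.2))

variable [CharZero K]

/-- The transformation law of double Eisenstein sums, from that of the sums with smaller `q`. -/
theorem isPiMultiple_doubleSum_inv {p q : ℕ} (hq : 1 ≤ q) (hpq : q + 1 ≤ p)
    (ih : ∀ q' < q, 1 ≤ q' → ∀ p', p' + q' = p + q → ∀ f (τ : K), IsQuadratic τ →
      IsPiMultiple (p + q) (fun σ => doubleSum p' q' f (σ τ)))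
    (g : ZMod 4 → ZMod 4 → ℚ) {τ : K} (hτ : IsQuadratic τ) :
    IsPiMultiple (p + q) (fun σ => doubleSum p q (fun a b => g b a) (σ τ⁻¹) -
      σ (τ ^ q * ((-τ) ^ p)⁻¹) * doubleSum p q g (σ τ)) := by
  obtain ⟨c, P, hc, h⟩ := exists_doubleSum_inv hq hpq g
  -- The error terms `i ≥ 1` have smaller `q`. The term `i = 0`, with `c 0 = 1`, is the main one.
  have h1 : IsPiMultiple (p + q) (fun σ : K →+* ℝ => ∑ i ∈ Finset.range (q - 1),
      σ ((c (i + 1) : K) * ((-τ) ^ (p + (i + 1)))⁻¹) *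
        doubleSum (p + (i + 1)) (q - (i + 1)) g (σ τ)) := by
    refine IsPiMultiple.sum _ fun i hi => IsPiMultiple.mul_left _ ?_
    have := Finset.mem_range.1 hi
    exact ih _ (by omega) (by omega) _ (by omega) g τ hτ
  have h2 : IsPiMultiple (p + q) (fun σ : K →+* ℝ =>
      Real.pi ^ (p + q) * Polynomial.aeval (σ τ)⁻¹ P) := by
    refine ⟨Polynomial.aeval τ⁻¹ P, fun σ => ?_⟩
    refine congrArg (Real.pi ^ (p + q) * ·) ?_
    have := Polynomial.hom_eval₂ P (algebraMap ℚ K) σ τ⁻¹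
    rw [Polynomial.aeval_def, Polynomial.aeval_def, this, map_inv₀,
      Subsingleton.elim (σ.comp (algebraMap ℚ K)) (algebraMap ℚ ℝ)]
  refine ((h1.add h2).mul_left (τ ^ q)).congr fun σ => ?_
  have hτ0 : σ τ ≠ 0 := by simpa using hτ.ne_zero
  have h3 := h (σ τ) (hτ.map σ).badlyApproximable
    (by rw [← map_inv₀]; exact ((isQuadratic_inv hτ).map σ).badlyApproximable)
  obtain ⟨q, rfl⟩ := Nat.exists_eq_add_of_le' hq
  rw [Finset.sum_range_succ', hc] at h3
  rw [inv_mul_eq_iff_eq_mul₀ (pow_ne_zero _ hτ0)] at h3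
  rw [map_inv₀, h3]
  simp only [map_mul, map_pow, map_inv₀, map_neg, map_ratCast, Nat.add_sub_cancel, add_zero,
    Nat.sub_zero, Rat.cast_one, one_mul, mul_assoc]
  ring

/-- Homogeneous coordinates turn the automorphy factor into a genuine action, so it suffices to
check the generators `S` and `T`. The equivalence of quadraticity is carried along because products
and inverses apply the law at a translated point. -/
theorem isPiMultiple_homSum_slMap {p q : ℕ} (hq : 1 ≤ q) (hpq : q + 1 ≤ p)
    (ih : ∀ q' < q, 1 ≤ q' → ∀ p', p' + q' = p + q → ∀ f (τ : K), IsQuadratic τ →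
      IsPiMultiple (p + q) (fun σ => doubleSum p' q' f (σ τ))) (γ : SL(2, ℤ)) :
    ∀ v : K × K, (IsQuadratic ((slMap γ v).1 / (slMap γ v).2) ↔ IsQuadratic (v.1 / v.2)) ∧
      (IsQuadratic (v.1 / v.2) → ∀ f, IsPiMultiple (p + q)
        (fun σ => homSum p q f (slMap γ v) σ - homSum p q (slAct γ f) v σ)) := by
  have hγ : γ ∈ Subgroup.closure {ModularGroup.S, ModularGroup.T} := by
    rw [SpecialLinearGroup.SL2Z_generators]
    trivial
  induction hγ using Subgroup.closure_induction with
  | mem γ hγ =>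
    rintro ⟨α, β⟩
    rcases hγ with rfl | rfl
    · have e1 : slMap ModularGroup.S (α, β) = (-β, α) := by
        simp [slMap, ModularGroup.S]
      have e2 : -β / α = -(α / β)⁻¹ := by rw [inv_div, neg_div]
      rw [e1]
      refine ⟨by simp only [e2, isQuadratic_neg_iff, isQuadratic_inv_iff], fun hτ f => ?_⟩
      simp only at hτ
      have hβ : β ≠ 0 := by
        rintro rfl
        exact hτ.ne_zero (div_zero α)
      have hα : α ≠ 0 := by
        rintro rfl
        exact hτ.ne_zero (zero_div β)
      have h := (isPiMultiple_doubleSum_inv hq hpq ih (fun n m => f (-m) n) hτ).mul_left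
        (α ^ (p - q) * (-1) ^ p)
      refine h.congr fun σ => ?_
      have e3 : slAct ModularGroup.S f = fun n m => f (-m) n := by
        ext n m
        simp [slAct, ModularGroup.S]
      have e4 : α ^ (p - q) * (-1) ^ p * ((α / β) ^ q * ((-(α / β)) ^ p)⁻¹) = β ^ (p - q) := by
        rw [neg_pow (α / β) p, mul_inv, ← inv_pow (-1 : K), inv_neg, inv_one]
        have e5 : ((-1 : K) ^ p) * (-1) ^ p = 1 := by rw [← mul_pow]; simp
        obtain ⟨d, rfl⟩ := Nat.exists_eq_add_of_le (show q ≤ p by omega)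
        rw [Nat.add_sub_cancel_left]
        calc _ = α ^ d * ((α / β) ^ q * ((α / β) ^ (q + d))⁻¹) *
              ((-1) ^ (q + d) * (-1) ^ (q + d)) := by ring
          _ = _ := by
            rw [e5, pow_add]
            field_simp
            rw [div_pow, div_mul_cancel₀ _ (pow_ne_zero _ hβ)]
      simp only [homSum, e3, e2]
      rw [map_neg, doubleSum_neg, mul_sub, ← mul_assoc (σ (α ^ (p - q) * _)), ← map_mul, e4]
      simp only [map_mul, map_pow, map_neg, map_one]
      ring
    · have e1 : slMap ModularGroup.T (α, β) = (α + β, β) := by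
        simp [slMap, ModularGroup.T]
      rw [e1]
      by_cases hβ : β = 0
      · subst hβ
        refine ⟨by simp, fun hτ => ?_⟩
        exact absurd (div_zero α) hτ.ne_zero
      have e2 : (α + β) / β = α / β + 1 := by field_simp
      simp only [e2]
      refine ⟨by simpa using isQuadratic_add_int_iff (τ := α / β) (k := 1), fun hτ f => ⟨0, ?_⟩⟩
      intro σ
      have e3 : slAct ModularGroup.T f = fun n m => f n (m - n) := by
        ext n m
        simp [slAct, ModularGroup.T]
      simp only [homSum, e3, e2, map_add, map_one, doubleSum_add_one, map_zero, mul_zero, sub_self]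
  | one =>
    intro v
    rw [slMap_one]
    exact ⟨Iff.rfl, fun _ f => ⟨0, by simp [slAct_one]⟩⟩
  | mul γ δ _ _ hγ hδ =>
    intro v
    rw [slMap_mul]
    refine ⟨(hγ _).1.trans (hδ v).1, fun hv f => ?_⟩
    have h1 := (hγ (slMap δ v)).2 ((hδ v).1.2 hv) f
    have h2 := (hδ v).2 hv (slAct γ f)
    refine (h1.add h2).congr fun σ => ?_
    rw [slAct_mul]
    ring
  | inv γ _ hγ =>
    intro v
    have e : slMap γ (slMap γ⁻¹ v) = v := by rw [← slMap_mul, mul_inv_cancel, slMap_one]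
    have e' : (IsQuadratic ((slMap γ⁻¹ v).1 / (slMap γ⁻¹ v).2) ↔ IsQuadratic (v.1 / v.2)) := by
      have := (hγ (slMap γ⁻¹ v)).1
      rw [e] at this
      exact this.symm
    refine ⟨e', fun hv f => ?_⟩
    have h1 := (hγ (slMap γ⁻¹ v)).2 (e'.2 hv) (slAct γ⁻¹ f)
    rw [e, ← slAct_mul, inv_mul_cancel, slAct_one] at h1
    exact h1.neg.congr fun σ => by ring

/-- Pell's equation: a matrix in the principal congruence subgroup of level `4` that fixes a
given real quadratic number. -/
theorem exists_slMap_eq_mul {τ : K} (hτ : IsQuadratic τ) (σ : K →+* ℝ) :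
    ∃ (γ : SL(2, ℤ)) (η : K), slMap γ (τ, 1) = (η * τ, η) ∧ (∀ f, slAct γ f = f) ∧
      ∀ r : ℚ, η ≠ r := by
  obtain ⟨hr, A, B, C, hA, h⟩ := hτ
  have hA' : (A : K) ≠ 0 := by exact_mod_cast hA
  -- The factor 16 puts `4 (2Aτ + B)` in the role of `√D` and makes the off-diagonal entries below
  -- divisible by 4.
  set D : ℤ := 16 * (B ^ 2 - 4 * A * C) with hD
  have hsq : (4 * (2 * A * τ + B)) ^ 2 = (D : K) := by
    rw [hD]
    push_cast
    linear_combination 64 * A * h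
  have hns : ¬ IsSquare D := by
    rintro ⟨k, hk⟩
    have h1 : (4 * (2 * A * τ + B) - k) * (4 * (2 * A * τ + B) + k) = 0 := by
      rw [hk] at hsq
      push_cast at hsq
      linear_combination hsq
    rcases mul_eq_zero.1 h1 with h1 | h1
    · apply hr ((k / 4 - B) / (2 * A))
      push_cast
      field_simp
      linear_combination h1
    · apply hr ((-k / 4 - B) / (2 * A))
      push_cast
      field_simp
      linear_combination h1
  have hpos : 0 < D := by
    have h1 : (0 : ℝ) ≤ D := by
      have := congrArg σ hsq
      rw [map_pow, map_intCast] at this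
      rw [← this]
      positivity
    have h2 : (0 : ℤ) ≤ D := by exact_mod_cast h1
    refine lt_of_le_of_ne h2 fun h0 => hns ⟨0, by rw [← h0]; rfl⟩
  obtain ⟨t₀, u₀, htu₀, hu₀⟩ := Pell.exists_of_not_isSquare hpos hns
  -- As `4 ∣ D`, `t₀` is odd; a change of sign makes it 1 modulo 4.
  obtain ⟨t, u, htu, hu, ht⟩ : ∃ t u : ℤ, t ^ 2 - D * u ^ 2 = 1 ∧ u ≠ 0 ∧ t % 4 = 1 := by
    have h1 : t₀ % 4 = 1 ∨ t₀ % 4 = 3 := by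
      have h2 : t₀ ^ 2 % 4 = 1 := by
        have : t₀ ^ 2 = 1 + 4 * (4 * (B ^ 2 - 4 * A * C) * u₀ ^ 2) := by
          rw [hD] at htu₀; linear_combination htu₀
        omega
      have h3 : t₀ % 4 = 0 ∨ t₀ % 4 = 1 ∨ t₀ % 4 = 2 ∨ t₀ % 4 = 3 := by omega
      rcases h3 with h3 | h3 | h3 | h3 <;> simp [pow_two, Int.mul_emod, h3] at h2 ⊢
    rcases h1 with h1 | h1
    · exact ⟨t₀, u₀, htu₀, hu₀, h1⟩
    · exact ⟨-t₀, -u₀, by rw [neg_sq, neg_sq]; exact htu₀, neg_ne_zero.2 hu₀, by omega⟩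
  have ht4 : (t : ZMod 4) = 1 := by
    have : ((t : ℤ) : ZMod 4) = ((1 : ℤ) : ZMod 4) :=
      (ZMod.intCast_eq_intCast_iff' t 1 4).2 (by simpa using ht)
    simpa using this
  have h4 : (4 : ZMod 4) = 0 := rfl
  have h8 : (8 : ZMod 4) = 0 := rfl
  -- Multiplication by the Pell unit `η = t + u √D` on the pair `(τ, 1)`; its norm is the
  -- determinant.
  refine ⟨⟨!![t - 4 * B * u, -8 * C * u; 8 * A * u, t + 4 * B * u], ?_⟩,
    8 * A * u * τ + (t + 4 * B * u), ?_, ?_, ?_⟩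
  · rw [Matrix.det_fin_two_of]
    rw [hD] at htu
    linear_combination htu
  · ext
    · simp [slMap]
      linear_combination (-8 * u : K) * h
    · simp [slMap]
  · intro f
    ext n m
    simp [slAct, ht4, h4, h8]
  · intro r hr'
    have hu' : (u : K) ≠ 0 := by exact_mod_cast hu
    apply hr ((r - (t + 4 * B * u)) / (8 * A * u))
    push_cast
    field_simp
    linear_combination hr'

theorem isPiMultiple_doubleSum (w : ℕ) : ∀ q p : ℕ, 1 ≤ q → q + 1 ≤ p → p + q = w →
    ∀ f (τ : K), IsQuadratic τ → IsPiMultiple w (fun σ => doubleSum p q f (σ τ)) := by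
  intro q
  induction q using Nat.strong_induction_on with
  | _ q ih =>
    intro p hq hpq hw f τ hτ
    subst hw
    -- Without a real embedding the claim is vacuous; with one, the discriminant is positive and
    -- Pell's equation is solvable.
    by_cases hσ : Nonempty (K →+* ℝ)
    swap
    · exact ⟨0, fun σ => absurd ⟨σ⟩ hσ⟩
    obtain ⟨σ₀⟩ := hσ
    obtain ⟨γ, η, hγ, hf, hη⟩ := exists_slMap_eq_mul hτ σ₀
    have h := (isPiMultiple_homSum_slMap hq hpq (fun q' hq' h1 p' hp' g τ' hτ' =>
      ih q' hq' p' h1 (by omega) hp' g τ' hτ') γ (τ, 1)).2 (by simpa using hτ) f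
    rw [hγ, hf] at h
    have hη0 : η ≠ 0 := by simpa using hη 0
    -- Here `p > q` matters: a real number with a positive power equal to 1 is `±1`, hence rational.
    have hη1 : η ^ (p - q) - 1 ≠ 0 := by
      intro h0
      have h1 : |σ₀ η| ^ (p - q) = 1 := by
        rw [← abs_pow, ← map_pow, sub_eq_zero.1 h0, map_one, abs_one]
      have h2 : |σ₀ η| = 1 := (pow_eq_one_iff_of_nonneg (abs_nonneg _) (by omega)).1 h1
      rcases eq_or_eq_neg_of_abs_eq h2 with h3 | h3
      · exact hη 1 (σ₀.injective (by simpa using h3))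
      · exact hη (-1) (σ₀.injective (by simpa using h3))
    refine (h.mul_left (η ^ (p - q) - 1)⁻¹).congr fun σ => ?_
    have hη2 : σ (η ^ (p - q) - 1) ≠ 0 := (map_ne_zero σ).2 hη1
    simp only [homSum, mul_div_cancel_left₀ τ hη0, div_one, map_one, one_pow, one_mul]
    rw [map_inv₀, ← sub_one_mul, ← map_pow, ← map_one σ, ← map_sub, inv_mul_cancel_left₀ hη2]

end

/-! ### The four trigonometric functions as weighted Eisenstein series. -/

theorem iteratedDeriv_eq_of_hasDerivAt {U : Set ℝ} (hU : IsOpen U) {F : ℝ → ℝ} {G : ℕ → ℝ → ℝ}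
    (h0 : ∀ x ∈ U, F x = G 0 x) (hG : ∀ j, ∀ x ∈ U, HasDerivAt (G j) (G (j + 1) x) x) (j : ℕ) :
    ∀ x ∈ U, iteratedDeriv j F x = G j x := by
  induction j with
  | zero => simpa using h0
  | succ j ih =>
    intro x hx
    have he : iteratedDeriv j F =ᶠ[nhds x] G j := by
      filter_upwards [hU.mem_nhds hx] with y hy using ih y hy
    rw [iteratedDeriv_succ, he.deriv_eq, (hG j x hx).deriv]

theorem hasDerivAt_wEisen (h : ZMod 4 → ℚ) (q : ℕ) {x : ℝ} (hx : ∀ m : ℤ, x + m ≠ 0) :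
    HasDerivAt (wEisen h (q + 1)) (-(q + 1) * wEisen h (q + 2) x) x := by
  have h1 : ∀ k ∈ (Finset.univ : Finset (ZMod 4)), HasDerivAt
      (fun y : ℝ => (h k : ℝ) * ((4 ^ (q + 1))⁻¹ * eisen (q + 1) ((y + k.val) / 4)))
      ((h k : ℝ) * ((4 ^ (q + 1))⁻¹ * (-(q + 1) * eisen (q + 2) ((x + k.val) / 4) * (1 / 4)))) x := by
    intro k _
    have hxk : ∀ m : ℤ, (x + k.val) / 4 + m ≠ 0 := by
      intro m h0
      apply hx (k.val + 4 * m)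
      push_cast
      linarith
    have h2 : HasDerivAt (fun y : ℝ => (y + k.val) / 4) (1 / 4) x :=
      ((hasDerivAt_id x).add_const _).div_const 4
    exact (((hasDerivAt_eisen q hxk).comp x h2).const_mul _).const_mul _
  convert! HasDerivAt.fun_sum h1 using 1
  rw [wEisen, Finset.mul_sum]
  refine Finset.sum_congr rfl fun k _ => ?_
  rw [pow_succ _ (q + 1), mul_inv]
  ring

theorem wEisen_one_eq (h : ZMod 4 → ℚ) (x : ℝ) :
    wEisen h 1 x = Real.pi / 4 *
      (h 0 * (Real.cos (Real.pi * x / 4) / Real.sin (Real.pi * x / 4)) +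
       h 1 * ((Real.cos (Real.pi * x / 4) - Real.sin (Real.pi * x / 4)) /
        (Real.cos (Real.pi * x / 4) + Real.sin (Real.pi * x / 4))) -
       h 2 * (Real.sin (Real.pi * x / 4) / Real.cos (Real.pi * x / 4)) -
       h 3 * ((Real.cos (Real.pi * x / 4) + Real.sin (Real.pi * x / 4)) /
        (Real.cos (Real.pi * x / 4) - Real.sin (Real.pi * x / 4)))) := by
  have h2 : √(2 : ℝ) ≠ 0 := by positivity
  have e : ∑ k : ZMod 4, (h k : ℝ) * ((4 ^ 1)⁻¹ * eisen 1 ((x + k.val) / 4)) =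
      (h 0 : ℝ) * ((4 ^ 1)⁻¹ * eisen 1 ((x + (0 : ℕ)) / 4)) +
      (h 1 : ℝ) * ((4 ^ 1)⁻¹ * eisen 1 ((x + (1 : ℕ)) / 4)) +
      (h 2 : ℝ) * ((4 ^ 1)⁻¹ * eisen 1 ((x + (2 : ℕ)) / 4)) +
      (h 3 : ℝ) * ((4 ^ 1)⁻¹ * eisen 1 ((x + (3 : ℕ)) / 4)) := Fin.sum_univ_four _
  rw [wEisen, e]
  simp only [eisen_one]
  set t := Real.pi * x / 4 with ht
  rw [show Real.pi * ((x + (0 : ℕ)) / 4) = t by rw [ht]; push_cast; ring,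
    show Real.pi * ((x + (1 : ℕ)) / 4) = t + Real.pi / 4 by rw [ht]; push_cast; ring,
    show Real.pi * ((x + (2 : ℕ)) / 4) = t + Real.pi / 2 by rw [ht]; push_cast; ring,
    show Real.pi * ((x + (3 : ℕ)) / 4) = (t + Real.pi / 4) + Real.pi / 2 by
      rw [ht]; push_cast; ring]
  rw [Real.cos_add_pi_div_two, Real.sin_add_pi_div_two, Real.cos_add_pi_div_two,
    Real.sin_add_pi_div_two, Real.cos_add, Real.sin_add, Real.cos_pi_div_four,
    Real.sin_pi_div_four, ← sub_mul, ← add_mul, mul_comm (_ - _) (√2 / 2), mul_comm (_ + _) (√2 / 2),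
    mul_div_mul_left _ _ (by positivity), neg_div, neg_div, mul_div_mul_left _ _ (by positivity),
    add_comm (Real.sin t)]
  ring

/-- The weight with the given values at the residues `0, 1, 2, 3` modulo `4`. -/
def weight4 (w₀ w₁ w₂ w₃ : ℚ) (k : ZMod 4) : ℚ :=
  if k = 0 then w₀ else if k = 1 then w₁ else if k = 2 then w₂ else w₃

theorem weight4_zero (w₀ w₁ w₂ w₃ : ℚ) : weight4 w₀ w₁ w₂ w₃ 0 = w₀ := rfl

theorem weight4_one (w₀ w₁ w₂ w₃ : ℚ) : weight4 w₀ w₁ w₂ w₃ 1 = w₁ := rfl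

theorem weight4_two (w₀ w₁ w₂ w₃ : ℚ) : weight4 w₀ w₁ w₂ w₃ 2 = w₂ := rfl

theorem weight4_three (w₀ w₁ w₂ w₃ : ℚ) : weight4 w₀ w₁ w₂ w₃ 3 = w₃ := rfl

/-- `trig^{a,b}(π n τ)` is a weighted Eisenstein series in `M n τ`. -/
def IsEisensteinTrig (a b : ℤ) (M : ℕ) (κ : ℚ) (f : ZMod 4 → ZMod 4 → ℚ) : Prop :=
  M ≠ 0 ∧ (∀ N : ℤ, ¬ (M : ℤ) ∣ N → f N = 0) ∧ ∀ (n : ℤ) (τ : ℝ),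
    Real.sin (Real.pi * (((M * n : ℤ) : ℝ) * τ)) ≠ 0 →
    wEisen (f ((M * n : ℤ))) 1 (((M * n : ℤ) : ℝ) * τ) =
      Real.pi * (κ * trig a b (Real.pi * n * τ))

theorem sin_four_mul_eq (t : ℝ) : Real.sin (4 * t) = 4 * (Real.sin t * Real.cos t) *
    ((Real.cos t + Real.sin t) * (Real.cos t - Real.sin t)) := by
  rw [show 4 * t = 2 * (2 * t) by ring, Real.sin_two_mul, Real.sin_two_mul, Real.cos_two_mul']
  ring

theorem isEisensteinTrig_cot : IsEisensteinTrig (-1) 1 1 1 (fun _ _ => 1) := by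
  refine ⟨one_ne_zero, fun N hN => absurd (one_dvd N) hN, fun n τ h => ?_⟩
  rw [wEisen_one_eq]
  push_cast at h ⊢
  simp only [one_mul] at h ⊢
  set t := Real.pi * (n * τ) / 4 with ht
  have e : Real.pi * (n * τ) = 4 * t := by rw [ht]; ring
  have e' : Real.pi * n * τ = 4 * t := by rw [ht]; ring
  rw [e, sin_four_mul_eq] at h
  simp only [mul_ne_zero_iff] at h
  obtain ⟨⟨_, h1, h2⟩, h3, h4⟩ := h
  rw [e', trig, sin_four_mul_eq, show 4 * t = 2 * (2 * t) by ring, Real.cos_two_mul',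
    Real.sin_two_mul, Real.cos_two_mul']
  simp only [zpow_neg, zpow_one, inv_inv]
  field_simp
  ring

/-- The alternating series `∑ (-1)^m / (x + m) = π / sin (π x)`. -/
theorem isEisensteinTrig_csc : IsEisensteinTrig 0 1 1 1 (fun _ => weight4 1 (-1) 1 (-1)) := by
  refine ⟨one_ne_zero, fun N hN => absurd (one_dvd N) hN, fun n τ h => ?_⟩
  rw [wEisen_one_eq]
  push_cast at h ⊢
  simp only [one_mul] at h ⊢
  set t := Real.pi * (n * τ) / 4 with ht
  have e : Real.pi * (n * τ) = 4 * t := by rw [ht]; ring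
  have e' : Real.pi * n * τ = 4 * t := by rw [ht]; ring
  rw [e, sin_four_mul_eq] at h
  simp only [mul_ne_zero_iff] at h
  obtain ⟨⟨_, h1, h2⟩, h3, h4⟩ := h
  have hsq : (Real.sin t ^ 2 + Real.cos t ^ 2) ^ 2 = 1 := by rw [Real.sin_sq_add_cos_sq, one_pow]
  rw [e', trig, sin_four_mul_eq, weight4_zero, weight4_one, weight4_two, weight4_three]
  simp only [zpow_zero, zpow_one]
  push_cast
  field_simp
  linear_combination hsq

/-- The indicator of the even residues modulo `4`. -/
def evenInd : ZMod 4 → ℚ := weight4 1 0 1 0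

theorem evenInd_of_not_two_dvd {N : ℤ} (h : ¬ (2 : ℤ) ∣ N) : evenInd N = 0 := by
  have h1 : N % 4 = 1 ∨ N % 4 = 3 := by omega
  rcases h1 with h1 | h1
  · have : (N : ZMod 4) = ((1 : ℤ) : ZMod 4) := (ZMod.intCast_eq_intCast_iff' N 1 4).2 h1
    rw [this]; rfl
  · have : (N : ZMod 4) = ((3 : ℤ) : ZMod 4) := (ZMod.intCast_eq_intCast_iff' N 3 4).2 h1
    rw [this]; rfl

theorem evenInd_two_mul (n : ℤ) : evenInd ((2 * n : ℤ)) = 1 := by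
  rcases (show (2 * n) % 4 = 0 ∨ (2 * n) % 4 = 2 by omega) with h1 | h1
  · have : ((2 * n : ℤ) : ZMod 4) = ((0 : ℤ) : ZMod 4) := (ZMod.intCast_eq_intCast_iff' _ 0 4).2 h1
    rw [this]; rfl
  · have : ((2 * n : ℤ) : ZMod 4) = ((2 : ℤ) : ZMod 4) := (ZMod.intCast_eq_intCast_iff' _ 2 4).2 h1
    rw [this]; rfl

/-- The poles of the tangent are half-integers, so the variable is doubled (`M = 2`) and only odd
`m` contribute; `evenInd` discards the odd `N`. -/
theorem isEisensteinTrig_tan :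
    IsEisensteinTrig 1 (-1) 2 (-1 / 2) (fun n k => evenInd n * weight4 0 1 0 1 k) := by
  refine ⟨two_ne_zero, fun N hN => ?_, fun n τ h => ?_⟩
  · ext k
    simp [evenInd_of_not_two_dvd (show ¬ (2 : ℤ) ∣ N by exact_mod_cast hN)]
  rw [wEisen_one_eq]
  simp only [Nat.cast_ofNat, evenInd_two_mul, one_mul]
  set t := Real.pi * (((2 * n : ℤ) : ℝ) * τ) / 4 with ht
  have e : Real.pi * (((2 * n : ℤ) : ℝ) * τ) = 4 * t := by rw [ht]; ring
  have e' : Real.pi * n * τ = 2 * t := by rw [ht]; push_cast; ring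
  simp only [Nat.cast_ofNat] at h
  rw [e, sin_four_mul_eq] at h
  simp only [mul_ne_zero_iff] at h
  obtain ⟨⟨_, h1, h2⟩, h3, h4⟩ := h
  rw [e', trig, Real.sin_two_mul, Real.cos_two_mul', weight4_zero, weight4_one, weight4_two, weight4_three,
    show Real.cos t ^ 2 - Real.sin t ^ 2 = (Real.cos t + Real.sin t) * (Real.cos t - Real.sin t) by
      ring]
  simp only [zpow_neg, zpow_one, inv_inv]
  push_cast
  field_simp
  ring

/-- As for the tangent, with the odd `m` now signed by the nontrivial character modulo 4. -/
theorem isEisensteinTrig_sec :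
    IsEisensteinTrig 1 0 2 (1 / 2) (fun n k => evenInd n * weight4 0 1 0 (-1) k) := by
  refine ⟨two_ne_zero, fun N hN => ?_, fun n τ h => ?_⟩
  · ext k
    simp [evenInd_of_not_two_dvd (show ¬ (2 : ℤ) ∣ N by exact_mod_cast hN)]
  rw [wEisen_one_eq]
  simp only [Nat.cast_ofNat, evenInd_two_mul, one_mul]
  set t := Real.pi * (((2 * n : ℤ) : ℝ) * τ) / 4 with ht
  have e : Real.pi * (((2 * n : ℤ) : ℝ) * τ) = 4 * t := by rw [ht]; ring
  have e' : Real.pi * n * τ = 2 * t := by rw [ht]; push_cast; ring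
  simp only [Nat.cast_ofNat] at h
  rw [e, sin_four_mul_eq] at h
  simp only [mul_ne_zero_iff] at h
  obtain ⟨⟨_, h1, h2⟩, h3, h4⟩ := h
  have hsq := Real.sin_sq_add_cos_sq t
  rw [e', trig, Real.cos_two_mul', weight4_zero, weight4_one, weight4_two, weight4_three,
    show Real.cos t ^ 2 - Real.sin t ^ 2 = (Real.cos t + Real.sin t) * (Real.cos t - Real.sin t) by
      ring]
  simp only [zpow_zero, zpow_one]
  push_cast
  field_simp
  linear_combination 4 * Real.sin t * Real.cos t * hsq

theorem trig_neg (a b : ℤ) (x : ℝ) : trig a b (-x) = (-1) ^ b * trig a b x := by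
  rw [trig, trig, Real.cos_neg, Real.sin_neg, inv_neg, neg_eq_neg_one_mul, mul_zpow]
  ring

theorem IsEisensteinTrig.iteratedDeriv_eq {a b : ℤ} {M : ℕ} {κ : ℚ} {f : ZMod 4 → ZMod 4 → ℚ}
    (h : IsEisensteinTrig a b M κ f) {ρ : ℝ} (hρ : BadlyApproximable ρ) (j : ℕ) {n : ℤ}
    (hn : n ≠ 0) :
    Real.pi * κ * iteratedDeriv j (fun τ => trig a b (Real.pi * n * τ)) ρ =
      (-1) ^ j * j.factorial * ((M * n : ℤ) : ℝ) ^ j *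
        wEisen (f ((M * n : ℤ))) (j + 1) (((M * n : ℤ) : ℝ) * ρ) := by
  obtain ⟨hM, -, h⟩ := h
  set N : ℤ := M * n with hN
  have hN0 : N ≠ 0 := mul_ne_zero (by exact_mod_cast hM) hn
  rw [← iteratedDeriv_const_mul_field]
  have hU : IsOpen {τ : ℝ | Real.sin (Real.pi * ((N : ℝ) * τ)) ≠ 0} :=
    isOpen_ne_fun (by fun_prop) continuous_const
  refine iteratedDeriv_eq_of_hasDerivAt hU (G := fun j τ => (-1) ^ j * j.factorial * (N : ℝ) ^ j *
    wEisen (f N) (j + 1) (N * τ)) ?_ ?_ j ρ (sin_pi_mul_ne_zero (hρ.mul_add_ne_zero hN0))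
  · intro τ hτ
    simp only [pow_zero, Nat.factorial_zero, Nat.cast_one, one_mul, mul_one, zero_add]
    rw [h n τ hτ, mul_assoc]
  · intro i τ hτ
    have h1 : HasDerivAt (fun y : ℝ => (N : ℝ) * y) N τ := by
      simpa using (hasDerivAt_id τ).const_mul (N : ℝ)
    have h2 := ((hasDerivAt_wEisen (f N) i (add_intCast_ne_zero_of_sin hτ)).comp τ h1).const_mul
      ((-1) ^ i * i.factorial * (N : ℝ) ^ i)
    convert! h2 using 1
    push_cast [Nat.factorial_succ]
    ring

theorem IsEisensteinTrig.exists_derivPsi_eq {a b : ℤ} {M : ℕ} {κ : ℚ} {f : ZMod 4 → ZMod 4 → ℚ}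
    (h : IsEisensteinTrig a b M κ f) (hκ : κ ≠ 0) {j s : ℕ} (hs : 2 * j + 2 ≤ s)
    (hpar : (s : ℤ) ≡ b [ZMOD 2]) : ∃ r : ℚ, ∀ ρ : ℝ, BadlyApproximable ρ →
      Summable (fun n : ℕ => derivTerm a b j s (n + 1) ρ) ∧
      derivPsi a b j s ρ = r * Real.pi⁻¹ * doubleSum (s - j) (j + 1) f ρ := by
  have hM : (M : ℝ) ≠ 0 := by exact_mod_cast h.1
  -- With `N = M n`, differentiation gives `(-1)^j j! N^j`, and `N^(-(s-j)) = N^j M^(-s) n^(-s)`;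
  -- `c` collects the resulting constants.
  set c : ℚ := κ * (-1) ^ j * (j.factorial * M ^ s : ℚ)⁻¹ with hc
  have hc0 : c ≠ 0 := by
    have : (j.factorial : ℚ) ≠ 0 := by exact_mod_cast j.factorial_ne_zero
    have : (M : ℚ) ≠ 0 := by exact_mod_cast h.1
    rw [hc]
    have : ((-1 : ℚ)) ^ j ≠ 0 := pow_ne_zero _ (by norm_num)
    positivity
  have hpi := Real.pi_ne_zero
  refine ⟨c⁻¹ / 2, fun ρ hρ => ?_⟩
  set t : ℤ → ℝ := fun n => iteratedDeriv j (fun τ => trig a b (Real.pi * n * τ)) ρ with ht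
  set u : ℤ → ℝ := fun n => (((M * n : ℤ) : ℝ) ^ (s - j))⁻¹ *
    wEisen (f ((M * n : ℤ))) (j + 1) (((M * n : ℤ) : ℝ) * ρ) with hu
  have hu0 : u 0 = 0 := by
    simp [hu, show s - j ≠ 0 by omega]
  have hut : ∀ n : ℤ, n ≠ 0 → u n = Real.pi * c * (t n / (n : ℝ) ^ s) := by
    intro n hn
    have h1 := h.iteratedDeriv_eq hρ j hn
    have hnR : (n : ℝ) ≠ 0 := by exact_mod_cast hn
    have hj : (j.factorial : ℝ) ≠ 0 := by exact_mod_cast j.factorial_ne_zero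
    have e : ((-1 : ℝ) ^ j) * (-1) ^ j = 1 := by rw [← mul_pow]; simp
    have hN : ((M * n : ℤ) : ℝ) ≠ 0 := by push_cast; exact mul_ne_zero hM hnR
    have e2 : (((M * n : ℤ) : ℝ) ^ (s - j))⁻¹ =
        ((M * n : ℤ) : ℝ) ^ j * (((M * n : ℤ) : ℝ) ^ s)⁻¹ := by
      rw [← pow_sub_mul_pow ((M * n : ℤ) : ℝ) (show j ≤ s by omega), mul_inv]
      field_simp
    have e3 : Real.pi * c * (t n / (n : ℝ) ^ s) = (-1) ^ j * (j.factorial * (M : ℝ) ^ s)⁻¹ *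
        ((n : ℝ) ^ s)⁻¹ * (Real.pi * κ * t n) := by
      rw [hc]
      push_cast
      ring
    rw [e3]
    simp only [ht]
    rw [h1]
    simp only [hu]
    rw [e2]
    have e4 : (((M * n : ℤ) : ℝ) ^ s)⁻¹ = ((M : ℝ) ^ s)⁻¹ * ((n : ℝ) ^ s)⁻¹ := by
      push_cast
      rw [mul_pow, mul_inv]
    rw [e4, mul_inv]
    generalize wEisen (f ((M * n : ℤ))) (j + 1) (((M * n : ℤ) : ℝ) * ρ) = W
    calc _ = ((M * n : ℤ) : ℝ) ^ j * (((M : ℝ) ^ s)⁻¹ * ((n : ℝ) ^ s)⁻¹) * W *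
          (((j.factorial : ℝ))⁻¹ * j.factorial) * ((-1 : ℝ) ^ j * (-1) ^ j) := by
          rw [e, inv_mul_cancel₀ hj, mul_one, mul_one]
      _ = _ := by ring
  have hsgn : ((-1 : ℝ)) ^ b = (-1) ^ s := by
    obtain ⟨k, hk⟩ := hpar.dvd
    rw [show b = s + 2 * k by omega, zpow_add₀ (by norm_num), zpow_natCast, zpow_mul]
    norm_num
  have htneg : ∀ n : ℤ, t (-n) = (-1) ^ s * t n := by
    intro n
    have e : (fun τ : ℝ => trig a b (Real.pi * ((-n : ℤ) : ℝ) * τ)) =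
        fun τ => (-1 : ℝ) ^ s * trig a b (Real.pi * n * τ) := by
      ext τ
      rw [← hsgn, ← trig_neg]
      congr 1
      push_cast
      ring
    simp only [ht]
    rw [e, iteratedDeriv_const_mul_field]
  -- The only use of `s ≡ b` modulo 2 here: it makes the sum over `ℤ` twice the sum over `n ≥ 1`.
  have hueven : ∀ n : ℤ, u (-n) = u n := by
    intro n
    rcases eq_or_ne n 0 with rfl | hn
    · simp
    · rw [hut _ (neg_ne_zero.2 hn), hut n hn, htneg]
      push_cast
      rw [neg_pow (n : ℝ), mul_div_mul_left _ _ (pow_ne_zero _ (by norm_num))]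
  have hS : HasSum u (doubleSum (s - j) (j + 1) f ρ) := by
    have h1 := hasSum_doubleSum hρ f (p := s - j) (q := j + 1) (by omega) (by omega)
    have hinj : Function.Injective fun n : ℤ => (M : ℤ) * n :=
      mul_right_injective₀ (by exact_mod_cast h.1)
    refine (hinj.hasSum_iff ?_).2 h1
    intro N hN
    have h2 : ¬ (M : ℤ) ∣ N := by
      rintro ⟨n, rfl⟩
      exact hN ⟨n, rfl⟩
    rw [h.2.1 N h2]
    simp [wEisen]
  have hS1 : HasSum (fun n : ℕ => u ((n + 1 : ℕ) : ℤ)) (doubleSum (s - j) (j + 1) f ρ / 2) := by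
    have h1 := hS.nat_add_neg.div_const 2
    simp only [hueven, hu0, add_zero] at h1
    have h2 := (hasSum_nat_add_iff' 1).2 h1
    simpa [hu0] using h2
  have hd : ∀ n : ℕ, derivTerm a b j s (n + 1) ρ = (Real.pi * c)⁻¹ * u ((n + 1 : ℕ) : ℤ) := by
    intro n
    have hcR : (c : ℝ) ≠ 0 := by exact_mod_cast hc0
    rw [hut _ (by exact_mod_cast Nat.succ_ne_zero n), inv_mul_cancel_left₀ (mul_ne_zero hpi hcR)]
    rw [derivTerm, show term a b s (n + 1) = fun τ =>
      trig a b (Real.pi * ((n + 1 : ℕ) : ℝ) * τ) / ((n + 1 : ℕ) : ℝ) ^ s from rfl,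
      iteratedDeriv_div_const]
    simp only [ht, Int.cast_natCast]
  have hfin : HasSum (fun n : ℕ => derivTerm a b j s (n + 1) ρ)
      ((Real.pi * c)⁻¹ * (doubleSum (s - j) (j + 1) f ρ / 2)) := by
    simp only [hd]
    exact hS1.mul_left _
  refine ⟨hfin.summable, ?_⟩
  rw [derivPsi, hfin.tsum_eq]
  push_cast
  rw [mul_inv]
  ring

theorem exists_isEisensteinTrig {a b : ℤ}
    (hab : (a, b) ∈ ({(1, 0), (0, 1), (-1, 1), (1, -1)} : Set (ℤ × ℤ))) :
    ∃ M κ f, κ ≠ 0 ∧ IsEisensteinTrig a b M κ f := by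
  simp only [Set.mem_insert_iff, Set.mem_singleton_iff, Prod.mk.injEq] at hab
  rcases hab with ⟨rfl, rfl⟩ | ⟨rfl, rfl⟩ | ⟨rfl, rfl⟩ | ⟨rfl, rfl⟩
  · exact ⟨_, _, _, by norm_num, isEisensteinTrig_sec⟩
  · exact ⟨_, _, _, by norm_num, isEisensteinTrig_csc⟩
  · exact ⟨_, _, _, by norm_num, isEisensteinTrig_cot⟩
  · exact ⟨_, _, _, by norm_num, isEisensteinTrig_tan⟩

/-! ### Reflection, Galois conjugation and conclusion. -/

theorem derivTerm_neg (a b : ℤ) (j s n : ℕ) (ρ : ℝ) :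
    derivTerm a b j s n (-ρ) = (-1) ^ b * (-1) ^ j * derivTerm a b j s n ρ := by
  have h1 : (fun τ => term a b s n (-τ)) = fun τ => (-1 : ℝ) ^ b * term a b s n τ := by
    ext τ
    rw [term, term, mul_neg, trig_neg, mul_div_assoc]
  have h2 := iteratedDeriv_comp_neg j (term a b s n) ρ
  rw [h1, iteratedDeriv_const_mul_field, smul_eq_mul] at h2
  have e : ((-1 : ℝ) ^ j) * (-1) ^ j = 1 := by rw [← mul_pow]; simp
  rw [derivTerm, derivTerm]
  linear_combination (-(-1 : ℝ) ^ j) * h2 - iteratedDeriv j (term a b s n) (-ρ) * e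

theorem derivPsi_neg (a b : ℤ) (j s : ℕ) (ρ : ℝ) :
    derivPsi a b j s (-ρ) = (-1) ^ b * (-1) ^ j * derivPsi a b j s ρ := by
  simp only [derivPsi, derivTerm_neg, tsum_mul_left]

open IntermediateField in
theorem exists_conj_of_sq_rat {ρ : ℝ} (hirr : Irrational ρ) {r : ℚ} (hr : ρ ^ 2 = r) (k : ℚ⟮ρ⟯) :
    ∃ (a b : ℚ) (σ : ℚ⟮ρ⟯ →+* ℝ), (k : ℝ) = a + b * ρ ∧ σ k = a - b * ρ ∧
      σ (AdjoinSimple.gen ℚ ρ) = -ρ := by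
  have hmonic : (Polynomial.X ^ 2 - Polynomial.C r).Monic :=
    Polynomial.monic_X_pow_sub_C r two_ne_zero
  have hint : IsIntegral ℚ ρ := ⟨_, hmonic, by simp [hr]⟩
  have hmin : minpoly ℚ ρ = Polynomial.X ^ 2 - Polynomial.C r := by
    refine (Polynomial.eq_of_monic_of_dvd_of_natDegree_le (minpoly.monic hint) hmonic
      (minpoly.dvd ℚ ρ (by simp [hr])) ?_).symm
    rw [Polynomial.natDegree_X_pow_sub_C]
    refine (minpoly.two_le_natDegree_iff hint).2 ?_
    rintro ⟨x, hx⟩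
    exact hirr ⟨x, by simpa using hx⟩
  have hroot : -ρ ∈ (minpoly ℚ ρ).aroots ℝ := by
    rw [Polynomial.mem_aroots]
    exact ⟨minpoly.ne_zero hint, by simp [hmin, hr]⟩
  obtain ⟨f, hf, hk⟩ := (adjoin.powerBasis hint).exists_eq_aeval k
  rw [adjoin.powerBasis_dim, hmin, Polynomial.natDegree_X_pow_sub_C] at hf
  obtain ⟨b, a, rfl⟩ := Polynomial.exists_eq_X_add_C_of_natDegree_le_one (Nat.lt_succ_iff.1 hf)
  have hgen : (adjoin.powerBasis hint).gen = AdjoinSimple.gen ℚ ρ := adjoin.powerBasis_gen hint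
  have hσ : ((algHomAdjoinIntegralEquiv ℚ hint).symm ⟨-ρ, hroot⟩) (AdjoinSimple.gen ℚ ρ) = -ρ :=
    algHomAdjoinIntegralEquiv_symm_apply_gen ℚ hint _
  refine ⟨a, b, ((algHomAdjoinIntegralEquiv ℚ hint).symm ⟨-ρ, hroot⟩ : ℚ⟮ρ⟯ →ₐ[ℚ] ℝ), ?_, ?_, hσ⟩
  · rw [hk, hgen]
    simp
    ring
  · rw [hk, hgen]
    simp only [map_add, map_mul, Polynomial.aeval_X, Polynomial.aeval_C, RingHom.coe_coe, hσ,
      eq_ratCast, map_ratCast]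
    ring

theorem isQuadratic_gen {ρ : ℝ} (hρ : IsRealQuadraticIrrationality ρ) :
    IsQuadratic (IntermediateField.AdjoinSimple.gen ℚ ρ) := by
  obtain ⟨hirr, A, B, C, hA, h⟩ := hρ
  refine ⟨fun r hr => hirr ⟨r, ?_⟩, A, B, C, hA, ?_⟩
  · have := congrArg (algebraMap _ ℝ) hr
    simpa using this.symm
  · apply (algebraMap (IntermediateField.adjoin ℚ {ρ}) ℝ).injective
    simpa using h

end TrigDirichlet

open TrigDirichlet in
theorem mainTheorem4 (a b : ℤ)
    (hab : (a, b) ∈ ({(1, 0), (0, 1), (-1, 1), (1, -1)} : Set (ℤ × ℤ)))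
    (ρ : ℝ) (hρ : TrigDirichlet.IsRealQuadraticIrrationality ρ)
    (j s : ℕ) (hs : 2 * j + 2 ≤ s) (hpar : (s : ℤ) ≡ b [ZMOD 2]) :
    Summable (fun n : ℕ => TrigDirichlet.derivTerm a b j s (n + 1) ρ) ∧
    (∃ x ∈ IntermediateField.adjoin ℚ ({ρ} : Set ℝ),
      TrigDirichlet.derivPsi a b j s ρ = Real.pi ^ s * x) ∧
    ((∃ r : ℚ, ρ ^ 2 = (r : ℝ)) →
      (∃ q : ℚ, TrigDirichlet.derivPsi a b j s ρ = (Real.pi * ρ) ^ s * ρ ^ j * (q : ℝ)) ∧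
      (Even j → ∃ q : ℚ, TrigDirichlet.derivPsi a b j s ρ = (Real.pi * ρ) ^ s * (q : ℝ))) := by
  obtain ⟨M, κ, f, hκ, hE⟩ := exists_isEisensteinTrig hab
  obtain ⟨r, hr⟩ := hE.exists_derivPsi_eq hκ hs hpar
  have hgen := isQuadratic_gen hρ
  obtain ⟨k, hk⟩ := isPiMultiple_doubleSum (s + 1) (j + 1) (s - j) (by omega) (by omega) (by omega)
    f _ hgen
  -- One `k` for all embeddings: the values at `ρ` and at its conjugate are conjugate, up to `π^s`.
  have hval : ∀ σ : IntermediateField.adjoin ℚ {ρ} →+* ℝ,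
      derivPsi a b j s (σ (IntermediateField.AdjoinSimple.gen ℚ ρ)) = Real.pi ^ s * (r * σ k) := by
    intro σ
    have hkσ : doubleSum (s - j) (j + 1) f (σ (IntermediateField.AdjoinSimple.gen ℚ ρ)) =
        Real.pi ^ (s + 1) * σ k := hk σ
    rw [(hr _ (hgen.map σ).badlyApproximable).2, hkσ, pow_succ]
    field_simp
  have hρval : derivPsi a b j s ρ = Real.pi ^ s * (r * k) := by
    simpa using hval (algebraMap _ ℝ)
  have hBA : BadlyApproximable ρ := by
    simpa using (hgen.map (algebraMap _ ℝ)).badlyApproximable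
  refine ⟨(hr ρ hBA).1, ⟨r * k, ?_, hρval⟩, ?_⟩
  · exact mul_mem (by simp) k.2
  rintro ⟨R, hR⟩
  have hρ0 : ρ ≠ 0 := hBA.ne_zero
  have hR0 : (R : ℝ) ≠ 0 := by rw [← hR]; positivity
  have hpow : ∀ i : ℕ, ρ ^ (i + i) = (R : ℝ) ^ i := fun i => by rw [← two_mul, pow_mul, hR]
  have hfirst : ∃ q : ℚ, derivPsi a b j s ρ = (Real.pi * ρ) ^ s * ρ ^ j * (q : ℝ) := by
    obtain ⟨x, y, σ, hkxy, hσk, hσ⟩ := exists_conj_of_sq_rat hρ.1 hR k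
    have hneg := hval σ
    have hsgn : ((-1 : ℝ)) ^ b = (-1) ^ s := by
      obtain ⟨c, hc⟩ := hpar.dvd
      rw [show b = s + 2 * c by omega, zpow_add₀ (by norm_num), zpow_natCast, zpow_mul]
      norm_num
    rw [hσ, derivPsi_neg, hρval, hσk, hkxy, hsgn, ← pow_add] at hneg
    have hpi : Real.pi ^ s ≠ 0 := pow_ne_zero _ Real.pi_ne_zero
    rw [mul_left_comm] at hneg
    have h1 := mul_left_cancel₀ hpi hneg
    -- With `k = x + yρ`, conjugation gives `r (x - yρ) = (-1)^(s+j) r (x + yρ)`. One coordinate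
    -- vanishes, and the surviving one matches `ρ^(s+j)` up to a rational factor.
    rcases Nat.even_or_odd (s + j) with he | ho
    · rw [he.neg_one_pow] at h1
      have h2 : (r : ℝ) * y = 0 := by
        apply mul_right_cancel₀ hρ0
        linear_combination h1 / 2
      obtain ⟨i, hi⟩ := he
      refine ⟨r * x / R ^ i, ?_⟩
      rw [hρval, hkxy, mul_pow, mul_assoc (Real.pi ^ s), ← pow_add, hi, hpow]
      push_cast
      field_simp
      linear_combination ρ * h2
    · rw [ho.neg_one_pow] at h1
      have h2 : (r : ℝ) * x = 0 := by
        linear_combination -h1 / 2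
      obtain ⟨i, hi⟩ := ho
      refine ⟨r * y / R ^ i, ?_⟩
      rw [hρval, hkxy, mul_pow, mul_assoc (Real.pi ^ s), ← pow_add, hi, pow_succ, two_mul, hpow]
      push_cast
      field_simp
      linear_combination h2
  refine ⟨hfirst, ?_⟩
  rintro ⟨i, rfl⟩
  obtain ⟨q, hq⟩ := hfirst
  exact ⟨R ^ i * q, by rw [hq, hpow]; push_cast; ring⟩
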